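/- Let $n\ge 1$ be an integer, $\lambda\in\mathbb R\setminus\{0\}$ and $\rho_c>0$. Consider the radial Euler–Poisson equations $$\text{(1)}\ \ r^{n-1}\rho_t+\partial_r(r^{n-1}\rho v)=0,\qquad \text{(2)}\ \ v_t+v\,\partial_r v+\lambda\,\partial_r\Phi=0,\qquad \text{(3)}\ \ \partial_r(r^{n-1}\partial_r\Phi)=r^{n-1}\rho$$ for $t\ge 0$, $r>0$, with initial data $\rho(0,r)=\rho_c$, $v(0,r)=0$ for $r\ge 0$. Put $D^0=C([0,\infty))$, $D^s=C([0,\infty))\cap C^s((0,\infty))$ for $1\le s\le\infty$, and let $C^k(I,D^s)$ be the space of functions $f(t,r)$ that are $C^k$ in $t\in I$ with values in $D^s$, where $C([0,\infty))$ and $C^s((0,\infty))$ carry the topology of locally uniform convergence (of the function, respectively of its derivatives up to order $s$). For $0<T\le\infty$, a solution on $[0,T)$ is a triple $$(\rho,v,\Phi)\in C^2([0,T),D^0)\times C^1([0,T),D^1)\times C^2([0,T),D^2)$$ satisfying (2), (3), the initial conditions, and (1) in the form $\partial_t m+v\,\partial_r m=0$ with $m(t,r)=\int_0^r\rho(t,s)s^{n-1}\,ds$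 (meaningful for densities that are not differentiable in $r$). It is global if $T=\infty$. Then a solution exists on $[0,T)$ for some $T>0$, and a global solution exists if and only if $\lambda<0$. If $\lambda<0$, there is a global solution $(\rho,v,\Phi)$ with $v(t,0)=0$ and $\Phi(t,0)=0$ for all $t\ge 0$ that also satisfies (1) itself classically, has the regularity $$\rho\in C^2([0,\infty),D^\infty)\cap C^\infty((0,\infty),D^\infty),\quad v\in C^1([0,\infty),D^\infty)\cap C^\infty((0,\infty),D^\infty),\quad \Phi\in C^2([0,\infty),D^\infty)\cap C^\infty((0,\infty),D^\infty),$$ and is unique up to adding a function of $t$ to the potential: every global solution $(\rho',v',\Phi')$ satisfies $\rho'=\rho$, $v'=v$ and $\Phi'(t,r)-\Phi'(t,0)=\Phi(t,r)$ for all $t,r\ge 0$. Moreover $\mathbf r(t,x)=\rho(t,|x|)$, $\mathbf v(t,x)=\frac{x}{|x|}v(t,|x|)$ (equal to $0$ at $x=0$), $\mathbf P(t,x)=\Phi(t,|x|)$ solve $$\mathbf r_t+\operatorname{div}(\mathbf r\mathbf v)=0,\qquad \mathbf v_t+\mathbf v\cdot\nabla\mathbf v=-\lambda\nabla\mathbf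 P,\qquad \Delta\mathbf P=\mathbf r$$ on $[0,\infty)\times\mathbb R^n$ in the distribution sense, i.e. when tested against $C_c^\infty([0,\infty)\times\mathbb R^n)$ with the initial values entering as boundary terms at $t=0$, and with $\nabla\mathbf v$ in $\mathbf v\cdot\nabla\mathbf v$ the locally integrable weak gradient of $\mathbf v$. -/

import Mathlib

open Set MeasureTheory
open scoped ContDiff

noncomputable section

namespace EulerPoisson

/-! ### Function spaces -/

/-- `D^s = C([0,∞)) ∩ C^s((0,∞))` (`s = ⊤` is `D^∞`). -/
def MemD (s : ℕ∞) (f : ℝ → ℝ) : Prop :=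
  ContinuousOn f (Ici 0) ∧ ContDiffOn ℝ s f (Ioi 0)

/-- `f ∈ C^k(I, D^s)` for a time interval `I`, where `C([0,∞))` and `C^s((0,∞))` carry locally
uniform convergence (of the function on `[0,∞)`, of its derivatives up to order `s` on `(0,∞)`).
Continuity in time with values in `D^s` is then joint continuity in `(t, r)`: the time derivatives
`∂_t^a f`, `a ≤ k`, exist, are jointly continuous on `I × [0,∞)`, lie in `D^s` at each time,
and their derivatives `∂_r^b ∂_t^a f`, `b ≤ s`, are jointly continuous on `I × (0,∞)`. -/
def MemCD (k s : ℕ∞) (I : Set ℝ) (f : ℝ → ℝ → ℝ) : Prop :=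
  (∀ r : ℝ, 0 ≤ r → ContDiffOn ℝ k (fun t => f t r) I) ∧
  ∀ a : ℕ, (a : ℕ∞) ≤ k →
    ContinuousOn (fun p : ℝ × ℝ => iteratedDerivWithin a (fun τ => f τ p.2) I p.1)
      (I ×ˢ Ici 0) ∧
    (∀ t ∈ I, MemD s (fun r => iteratedDerivWithin a (fun τ => f τ r) I t)) ∧
    ∀ b : ℕ, (b : ℕ∞) ≤ s →
      ContinuousOn
        (fun p : ℝ × ℝ =>
          iteratedDerivWithin b (fun r => iteratedDerivWithin a (fun τ => f τ r) I p.1)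
            (Ioi 0) p.2)
        (I ×ˢ Ioi 0)

/-- The time interval `[0, T)`, `T ∈ (0, ∞]`. -/
def timeInterval (T : EReal) : Set ℝ := {t : ℝ | 0 ≤ t ∧ (t : EReal) < T}

/-! ### The radial Euler-Poisson equations -/

/-- The mass `m(t,r) = ∫_0^r ρ(t,s) s^{n-1} ds`. -/
def mass (n : ℕ) (ρ : ℝ → ℝ → ℝ) (t r : ℝ) : ℝ := ∫ s in (0 : ℝ)..r, ρ t s * s ^ (n - 1)

/-- `r^{n-1} ρ_t + ∂_r (r^{n-1} ρ v) = 0` for `0 ≤ t < T`, `r > 0`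
(the time derivative is one-sided at `t = 0`). -/
def ContinuityEquation (n : ℕ) (T : EReal) (ρ v : ℝ → ℝ → ℝ) : Prop :=
  ∀ t ∈ timeInterval T, ∀ r : ℝ, 0 < r →
    r ^ (n - 1) * derivWithin (fun τ => ρ τ r) (timeInterval T) t
      + deriv (fun x => x ^ (n - 1) * ρ t x * v t x) r = 0

/-- `(ρ, v, Φ)` is a classical solution on `[0, T)` of the radial Euler-Poisson equations with
initial data `(ρ₀, v₀)`, in the class `C²([0,T),D⁰) × C¹([0,T),D¹) × C²([0,T),D²)`.
Densities in this class need not be differentiable in `r`, so conservation of mass is expressed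
by `∂_t m + v ∂_r m = 0`. -/
structure IsRadialSolution (n : ℕ) (lam : ℝ) (ρ₀ v₀ : ℝ → ℝ) (T : EReal)
    (ρ v Φ : ℝ → ℝ → ℝ) : Prop where
  density_mem : MemCD 2 0 (timeInterval T) ρ
  velocity_mem : MemCD 1 1 (timeInterval T) v
  potential_mem : MemCD 2 2 (timeInterval T) Φ
  mass_eq : ∀ t ∈ timeInterval T, ∀ r : ℝ, 0 < r →
    derivWithin (fun τ => mass n ρ τ r) (timeInterval T) t
      + v t r * deriv (fun x => mass n ρ t x) r = 0
  momentum_eq : ∀ t ∈ timeInterval T, ∀ r : ℝ, 0 < r →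
    derivWithin (fun τ => v τ r) (timeInterval T) t + v t r * deriv (v t) r
      + lam * deriv (Φ t) r = 0
  poisson_eq : ∀ t ∈ timeInterval T, ∀ r : ℝ, 0 < r →
    deriv (fun x => x ^ (n - 1) * deriv (Φ t) x) r = r ^ (n - 1) * ρ t r
  density_init : ∀ r : ℝ, 0 ≤ r → ρ 0 r = ρ₀ r
  velocity_init : ∀ r : ℝ, 0 ≤ r → v 0 r = v₀ r

/-! ### Distributional solutions of the Euler-Poisson equations in `ℝⁿ` -/

/-- Space-time `ℝ × ℝⁿ`. -/
abbrev SpaceTime (n : ℕ) : Type := ℝ × EuclideanSpace ℝ (Fin n)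

/-- The closed half space-time `[0,∞) × ℝⁿ`. -/
def halfSpace (n : ℕ) : Set (SpaceTime n) := Ici 0 ×ˢ univ

/-- `∂_t φ`. -/
def dt {n : ℕ} (φ : SpaceTime n → ℝ) (p : SpaceTime n) : ℝ := fderiv ℝ φ p (1, 0)

/-- `∂φ/∂x_i`. -/
def dx {n : ℕ} (i : Fin n) (φ : SpaceTime n → ℝ) (p : SpaceTime n) : ℝ :=
  fderiv ℝ φ p (0, EuclideanSpace.single i 1)

/-- Test functions in `C_c^∞([0,∞) × ℝⁿ)` are the restrictions to `t ≥ 0` of these. -/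
def IsTest {n : ℕ} (φ : SpaceTime n → ℝ) : Prop := ContDiff ℝ ∞ φ ∧ HasCompactSupport φ

/-- `g ∈ L¹_loc([0,∞) × ℝⁿ)` is the weak derivative `∂f/∂x_j`. -/
def HasWeakDx {n : ℕ} (j : Fin n) (f g : SpaceTime n → ℝ) : Prop :=
  LocallyIntegrableOn g (halfSpace n) ∧
  ∀ φ : SpaceTime n → ℝ, IsTest φ →
    ∫ p in halfSpace n, g p * φ p = - ∫ p in halfSpace n, f p * dx j φ p

/-- `(r, u, P)` solves `r_t + div (r u) = 0`, `u_t + u · ∇u = -lam ∇P`, `ΔP = r` on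
`[0,∞) × ℝⁿ` in the distribution sense, with test functions that may be nonzero at `t = 0`
(hence the terms at the initial time). In `u · ∇u` the matrix `∇u = (∂u_i/∂x_j)` is the weak
gradient of `u`. All fields and products that occur are locally integrable. -/
structure IsDistributionalSolution {n : ℕ} (lam : ℝ) (r : SpaceTime n → ℝ)
    (u : SpaceTime n → EuclideanSpace ℝ (Fin n)) (P : SpaceTime n → ℝ) : Prop where
  density_int : LocallyIntegrableOn r (halfSpace n)
  density_init_int : LocallyIntegrable (fun x => r (0, x))
  velocity_int : ∀ i, LocallyIntegrableOn (fun p => u p i) (halfSpace n)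
  velocity_init_int : ∀ i, LocallyIntegrable (fun x => u (0, x) i)
  potential_int : LocallyIntegrableOn P (halfSpace n)
  flux_int : ∀ i, LocallyIntegrableOn (fun p => r p * u p i) (halfSpace n)
  continuity_eq : ∀ φ : SpaceTime n → ℝ, IsTest φ →
    (∫ p in halfSpace n, (r p * dt φ p + ∑ i, r p * u p i * dx i φ p))
      + ∫ x, r (0, x) * φ (0, x) = 0
  momentum_eq : ∃ G : Fin n → Fin n → SpaceTime n → ℝ,
    (∀ i j, HasWeakDx j (fun p => u p i) (G i j)) ∧
    (∀ i j, LocallyIntegrableOn (fun p => u p j * G i j p) (halfSpace n)) ∧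
    ∀ i, ∀ φ : SpaceTime n → ℝ, IsTest φ →
      (∫ p in halfSpace n,
          (u p i * dt φ p - (∑ j, u p j * G i j p) * φ p + lam * P p * dx i φ p))
        + ∫ x, u (0, x) i * φ (0, x) = 0
  poisson_eq : ∀ φ : SpaceTime n → ℝ, IsTest φ →
    ∫ p in halfSpace n, P p * ∑ i, dx i (dx i φ) p = ∫ p in halfSpace n, r p * φ p

/-- The scalar field `f(t, |x|)` of a radial profile. -/
def radialScalar (n : ℕ) (f : ℝ → ℝ → ℝ) (p : SpaceTime n) : ℝ := f p.1 ‖p.2‖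

/-- The vector field `(x/|x|) v(t, |x|)` of a radial profile. -/
def radialVector (n : ℕ) (v : ℝ → ℝ → ℝ) (p : SpaceTime n) : EuclideanSpace ℝ (Fin n) :=
  (v p.1 ‖p.2‖ / ‖p.2‖) • p.2

end EulerPoisson

end

/-!
The solution is explicit. A gas of constant density at rest stays homogeneous: with
`n = d + 1` and `k = lam * ρc / n`, put `ρ = ρc / a(t)ⁿ`, `v = (a'/a) r`, `Φ = ρ r² / (2n)`, where
the scale factor `a` solves `a'' = -k / a^d`, `a(0) = 1`, `a'(0) = 0`. All equations, radial or
distributional, then reduce to identities for `a` (`isRadialSolution_homogeneous`,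
`isDistributionalSolution_homogeneous`). For `k < 0` the scale factor is convex, stays `≥ 1` and is
smooth on all of `ℝ`, which gives the global solution. For `k > 0` it is concave and falls to any
level `ε ∈ (0, 1)` by the fixed time `√(2/k)`. To avoid a maximal interval of existence, the
singular force is truncated to `-k / max(a, ε)^d`, which is bounded and Lipschitz and has a global
trajectory (`exists_truncated_scaleFactor`).

The main point is that every global solution coincides with the homogeneous one as long as `a > 0`
(`IsRadialSolution.eq_homogeneous`). Poisson's equation gives `r^d Φ_r = m + C(t)`. If `C = 0`,
the defects `v(t, Ra) - R a'` and `m(t, Ra) - ρc Rⁿ/n` along the curve `r = R a(t)` solve a linear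
homogeneous system with continuous coefficients and zero data, so they vanish
(`IsRadialSolution.along_homogeneous_flow`); no flow of the unknown velocity is needed. That
`C(t) = 0` wherever `ρ(t, 0) > 0` is `IsRadialSolution.flux_eq_mass`: conservation of mass forces
`v = O(r)`, hence `v_t → 0` at the centre, so the Bernoulli function `v²/2 + lam Φ`, and with it
`Φ`, has zero slope there, while `C ≠ 0` would keep `|Φ_r|` above `|C|/2`. Finally `ρ(t, 0) > 0`
persists, because up to a first zero the density is `ρc / aⁿ` (`IsRadialSolution.density_center_pos`).

Uniqueness yields the breakdown for `lam > 0` as well: the density of a global solution would take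
the values `ρc / εⁿ` for all small `ε` on a compact time interval.
-/

namespace EulerPoisson

open Filter Topology

/-! ### The scale factor -/

/-- A bounded Lipschitz vector field has trajectories on every interval: the speed bound `L` keeps a
trajectory of duration `T` in the ball of radius `L * T`, so Picard–Lindelöf needs no smallness. -/
theorem exists_hasDerivAt_Ioo_of_bounded {E : Type*} [NormedAddCommGroup E] [NormedSpace ℝ E]
    [CompleteSpace E] {F : E → E} {K : NNReal} (hF : LipschitzWith K F) {L : NNReal}
    (hL : ∀ x, ‖F x‖ ≤ L) (x₀ : E) {T : ℝ} (hT : 0 < T) :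
    ∃ α : ℝ → E, α 0 = x₀ ∧ ∀ t ∈ Ioo (-T) T, HasDerivAt α (F (α t)) t := by
  have hp : IsPicardLindelof (fun _ => F) (tmin := -T) (tmax := T) ⟨0, by constructor <;> linarith⟩
      x₀ (L * T.toNNReal) 0 L K :=
    { lipschitzOnWith := fun t _ => hF.lipschitzOnWith
      continuousOn := fun x _ => continuousOn_const
      norm_le := fun t _ x _ => hL x
      mul_max_le := by simp [hT.le] }
  obtain ⟨α, h0, hα⟩ := hp.exists_eq_forall_mem_Icc_hasDerivWithinAt₀
  exact ⟨α, h0, fun t ht => (hα t (Ioo_subset_Icc_self ht)).hasDerivAt (Icc_mem_nhds ht.1 ht.2)⟩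

/-- The equation `x'' = f(x)`, `x(0) = x₀`, `x'(0) = 0` as a first-order system on `(-T, T)`. -/
theorem exists_fall_from_rest_Ioo {f : ℝ → ℝ} {K : NNReal} (hf : LipschitzWith K f) {M : ℝ}
    (hM : ∀ x, |f x| ≤ M) (x₀ : ℝ) {T : ℝ} (hT : 0 < T) :
    ∃ α : ℝ → ℝ × ℝ, α 0 = (x₀, 0) ∧
      ∀ t ∈ Ioo (-T) T, HasDerivAt α ((α t).2, f (α t).1) t := by
  have hM0 : 0 ≤ M := (abs_nonneg _).trans (hM 0)
  have hMT : 0 ≤ M * T := by positivity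
  -- Clipping the velocity at its a priori bound `M * T` makes the system bounded.
  set c : ℝ → ℝ := fun y => max (-(M * T)) (min y (M * T)) with hc
  have hcb : ∀ y, |c y| ≤ M * T := fun y => by
    rw [abs_le]; constructor
    · exact le_max_left _ _
    · exact max_le (by linarith) (min_le_right _ _)
  have hcl : LipschitzWith 1 c := (LipschitzWith.id.min_const (M * T)).const_max _
  have hF : LipschitzWith (max (1 * 1) (K * 1)) (fun p : ℝ × ℝ => (c p.2, f p.1)) :=
    (hcl.comp LipschitzWith.prod_snd).prodMk (hf.comp LipschitzWith.prod_fst)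
  obtain ⟨α, h0, hα⟩ := exists_hasDerivAt_Ioo_of_bounded hF (L := (max (M * T) M).toNNReal)
    (fun p => by
      rw [Real.coe_toNNReal _ (le_max_of_le_right hM0), Prod.norm_def]
      exact max_le_max (hcb _) (hM _)) (x₀, 0) hT
  refine ⟨α, h0, fun t ht => ?_⟩
  have h2 : ∀ s ∈ Ioo (-T) T, HasDerivAt (fun s => (α s).2) (f (α s).1) s := fun s hs =>
    (hasFDerivAt_snd (𝕜 := ℝ) (p := α s)).comp_hasDerivAt s (hα s hs)
  have hy : |(α t).2| ≤ M * T := by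
    have := (convex_Ioo (-T) T).norm_image_sub_le_of_norm_hasDerivWithin_le
      (fun s hs => (h2 s hs).hasDerivWithinAt) (fun s _ => hM _)
      (show (0 : ℝ) ∈ Ioo (-T) T from ⟨by linarith, hT⟩) ht
    rw [h0] at this
    simp only [sub_zero, Real.norm_eq_abs] at this
    exact this.trans (by gcongr; exact abs_le.2 ⟨ht.1.le, ht.2.le⟩)
  have : c (α t).2 = (α t).2 := by
    rw [abs_le] at hy
    simp only [hc]; rw [min_eq_left hy.2, max_eq_right hy.1]
  have h := hα t ht
  rwa [this] at h

/-- Global solution of `x'' = f(x)` started at rest, for `f` bounded and Lipschitz. -/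
theorem exists_fall_from_rest {f : ℝ → ℝ} {K : NNReal} (hf : LipschitzWith K f) {M : ℝ}
    (hM : ∀ x, |f x| ≤ M) (x₀ : ℝ) :
    ∃ a b : ℝ → ℝ, a 0 = x₀ ∧ b 0 = 0 ∧ (∀ t, HasDerivAt a (b t) t) ∧
      ∀ t, HasDerivAt b (f (a t)) t := by
  have hG : LipschitzWith (max (1) (K * 1)) (fun p : ℝ × ℝ => (p.2, f p.1)) :=
    LipschitzWith.prod_snd.prodMk (hf.comp LipschitzWith.prod_fst)
  have ex : ∀ t : ℝ, ∃ α : ℝ → ℝ × ℝ, α 0 = (x₀, 0) ∧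
      ∀ s ∈ Ioo (-(|t| + 1)) (|t| + 1), HasDerivAt α ((α s).2, f (α s).1) s := fun t =>
    exists_fall_from_rest_Ioo hf hM x₀ (by positivity)
  choose α h0 hα using ex
  -- The solutions on growing intervals agree where both are defined, so they glue.
  have agree : ∀ t s r : ℝ, |r| < |t| + 1 → |r| < |s| + 1 → α t r = α s r := by
    intro t s r h1 h2
    have hm : |r| < min (|t| + 1) (|s| + 1) := lt_min h1 h2
    refine ODE_solution_unique_of_mem_Ioo (v := fun _ p => (p.2, f p.1)) (s := fun _ => univ)
      (a := -(min (|t| + 1) (|s| + 1))) (b := min (|t| + 1) (|s| + 1)) (t₀ := 0)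
      (fun _ _ => hG.lipschitzOnWith) ?_ (fun u hu => ⟨hα t u ?_, trivial⟩)
      (fun u hu => ⟨hα s u ?_, trivial⟩) ((h0 t).trans (h0 s).symm) (abs_lt.1 hm)
    · have : 0 < min (|t| + 1) (|s| + 1) := (abs_nonneg r).trans_lt hm
      exact ⟨by linarith, this⟩
    · exact abs_lt.1 ((abs_lt.2 hu).trans_le (min_le_left _ _))
    · exact abs_lt.1 ((abs_lt.2 hu).trans_le (min_le_right _ _))
  have key : ∀ t, HasDerivAt (fun s => α s s) ((α t t).2, f (α t t).1) t := by
    intro t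
    have ht : |t| < |t| + 1 := by linarith
    refine (hα t t (abs_lt.1 ht)).congr_of_eventuallyEq ?_
    filter_upwards [(continuous_abs.tendsto t).eventually (gt_mem_nhds ht)] with s hs
    exact agree s t s (by linarith) hs
  refine ⟨fun t => (α t t).1, fun t => (α t t).2, by simp [h0], by simp [h0], fun t => ?_,
    fun t => ?_⟩
  · exact (hasFDerivAt_fst (𝕜 := ℝ)).comp_hasDerivAt (f := fun s => α s s) t (key t)
  · exact (hasFDerivAt_snd (𝕜 := ℝ)).comp_hasDerivAt (f := fun s => α s s) t (key t)

theorem lipschitzWith_truncated_force (d : ℕ) (k : ℝ) {ε : ℝ} (hε : 0 < ε) :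
    ∃ K, LipschitzWith K (fun x : ℝ => -k / max x ε ^ d) := by
  have hm : LipschitzWith 1 (fun x : ℝ => max x ε) := LipschitzWith.id.max_const ε
  have h1 : LipschitzOnWith (|k| * (d * (ε ^ (d + 1))⁻¹)).toNNReal (fun y : ℝ => -k / y ^ d)
      (Ici ε) := by
    refine (convex_Ici ε).lipschitzOnWith_of_nnnorm_hasDerivWithin_le
      (f' := fun y => -k * (-(d : ℝ) * y ^ (-(d : ℤ) - 1))) (fun y hy => ?_) (fun y hy => ?_)
    · have hy0 : y ≠ 0 := (hε.trans_le hy).ne'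
      have := ((hasDerivAt_zpow (-(d : ℤ)) y (Or.inl hy0)).const_mul (-k)).hasDerivWithinAt
        (s := Ici ε)
      simpa [div_eq_mul_inv] using this
    · have hy0 : 0 < y := hε.trans_le hy
      rw [← NNReal.coe_le_coe, Real.coe_toNNReal _ (by positivity), coe_nnnorm, norm_mul, norm_mul,
        norm_neg, norm_neg, Real.norm_eq_abs, Real.norm_natCast]
      have : y ^ (-(d : ℤ) - 1) = (y ^ (d + 1))⁻¹ := by
        rw [← zpow_natCast, ← zpow_neg]; congr 1; push_cast; ring
      rw [this, norm_inv, norm_pow, Real.norm_of_nonneg hy0.le]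
      have : ε ≤ y := hy
      gcongr
  exact ⟨_, lipschitzOnWith_univ.1
    (h1.comp (hm.lipschitzOnWith (s := univ)) fun x _ => le_max_right x ε)⟩

/-- The scale factor equation with the force frozen below the level `ε`. -/
theorem exists_truncated_scaleFactor (d : ℕ) (k : ℝ) {ε : ℝ} (hε : 0 < ε) :
    ∃ a b : ℝ → ℝ, a 0 = 1 ∧ b 0 = 0 ∧ (∀ t, HasDerivAt a (b t) t) ∧
      ∀ t, HasDerivAt b (-k / max (a t) ε ^ d) t := by
  obtain ⟨K, hK⟩ := lipschitzWith_truncated_force d k hε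
  refine exists_fall_from_rest hK (M := |k| / ε ^ d) (fun x => ?_) 1
  rw [abs_div, abs_neg, abs_of_pos (pow_pos (lt_max_of_lt_right hε) d)]
  gcongr
  exact le_max_right _ _

theorem exists_scaleFactor_of_neg (d : ℕ) {k : ℝ} (hk : k < 0) :
    ∃ a b : ℝ → ℝ, a 0 = 1 ∧ b 0 = 0 ∧ (∀ t, 1 ≤ a t) ∧ (∀ t, HasDerivAt a (b t) t) ∧
      ∀ t, HasDerivAt b (-k / a t ^ d) t := by
  obtain ⟨a, b, ha0, hb0, ha, hb⟩ := exists_truncated_scaleFactor d k one_pos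
  have hbm : Monotone b := monotone_of_hasDerivAt_nonneg hb fun t =>
    div_nonneg (by linarith) (pow_nonneg (le_max_of_le_right zero_le_one) _)
  have hac : Continuous a := continuous_iff_continuousAt.2 fun t => (ha t).continuousAt
  have h1 : ∀ t, 1 ≤ a t := by
    intro t
    rcases le_total 0 t with ht | ht
    · have : MonotoneOn a (Ici 0) := monotoneOn_of_hasDerivWithinAt_nonneg (convex_Ici 0)
        hac.continuousOn (fun x _ => (ha x).hasDerivWithinAt) fun x hx => by
          rw [interior_Ici] at hx
          exact hb0 ▸ hbm (le_of_lt hx)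
      exact ha0 ▸ this self_mem_Ici ht ht
    · have : AntitoneOn a (Iic 0) := antitoneOn_of_hasDerivWithinAt_nonpos (convex_Iic 0)
        hac.continuousOn (fun x _ => (ha x).hasDerivWithinAt) fun x hx => by
          rw [interior_Iic] at hx
          exact hb0 ▸ hbm (le_of_lt hx)
      exact ha0 ▸ this ht self_mem_Iic ht
  refine ⟨a, b, ha0, hb0, h1, ha, fun t => ?_⟩
  have := hb t
  rwa [max_eq_left (h1 t)] at this

/-- For an attractive force the scale factor decreases from `1` to any level `ε < 1`, within a time
that is bounded independently of `ε`. -/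
theorem exists_scaleFactor_hitting_of_pos (d : ℕ) {k : ℝ} (hk : 0 < k) {ε : ℝ} (hε : 0 < ε)
    (hε1 : ε < 1) :
    ∃ (a b : ℝ → ℝ) (t₁ : ℝ), 0 < t₁ ∧ t₁ ≤ √(2 / k) ∧ a 0 = 1 ∧ b 0 = 0 ∧ a t₁ = ε ∧
      (∀ t ∈ Icc 0 t₁, ε ≤ a t) ∧ (∀ t, HasDerivAt a (b t) t) ∧
      ∀ t ∈ Icc 0 t₁, HasDerivAt b (-k / a t ^ d) t := by
  obtain ⟨a, b, ha0, hb0, ha, hb⟩ := exists_truncated_scaleFactor d k hε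
  have hac : Continuous a := continuous_iff_continuousAt.2 fun t => (ha t).continuousAt
  have hbc : Continuous b := continuous_iff_continuousAt.2 fun t => (hb t).continuousAt
  have hbm : Antitone b := antitone_of_hasDerivAt_nonpos hb fun t =>
    div_nonpos_of_nonpos_of_nonneg (by linarith) (pow_nonneg (le_max_of_le_right hε.le) _)
  have ham : AntitoneOn a (Ici 0) := antitoneOn_of_hasDerivWithinAt_nonpos (convex_Ici 0)
    hac.continuousOn (fun x _ => (ha x).hasDerivWithinAt) fun x hx => by
      rw [interior_Ici] at hx
      exact hb0 ▸ hbm (le_of_lt hx)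
  have ha1 : ∀ t, 0 ≤ t → a t ≤ 1 := fun t ht => ha0 ▸ ham self_mem_Ici ht ht
  have hbk : ∀ t, 0 ≤ t → b t ≤ -k * t := by
    have : AntitoneOn (fun t => b t - -k * t) (Ici 0) :=
      antitoneOn_of_hasDerivWithinAt_nonpos (convex_Ici 0) (by fun_prop)
        (fun x _ => ((hb x).sub ((hasDerivAt_id x).const_mul (-k))).hasDerivWithinAt)
        fun x hx => by
          rw [interior_Ici] at hx
          have h0 : 0 < max (a x) ε := lt_max_of_lt_right hε
          have : max (a x) ε ^ d ≤ 1 :=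
            pow_le_one₀ h0.le (max_le (ha1 x (le_of_lt hx)) hε1.le)
          have : k ≤ k / max (a x) ε ^ d := by
            rw [le_div_iff₀ (pow_pos h0 d)]; nlinarith
          rw [neg_div]; linarith
    intro t ht
    have := this self_mem_Ici ht ht
    simp only [hb0] at this; linarith
  have hak : ∀ t, 0 ≤ t → a t ≤ 1 - k * t ^ 2 / 2 := by
    have : AntitoneOn (fun t => a t + k * t ^ 2 / 2) (Ici 0) :=
      antitoneOn_of_hasDerivWithinAt_nonpos (convex_Ici 0) (by fun_prop)
        (f' := fun x => b x + k * x)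
        (fun x _ => by
          have := (ha x).add (((hasDerivAt_pow 2 x).const_mul (k / 2)))
          refine HasDerivAt.hasDerivWithinAt ?_
          convert! this using 1
          · ext y; simp; ring
          · simp; ring)
        fun x hx => by
          rw [interior_Ici] at hx
          have := hbk x (le_of_lt hx)
          linarith
    intro t ht
    have := this self_mem_Ici ht ht
    simp only [ha0] at this; linarith
  have hend : a √(2 / k) ≤ 0 := by
    have := hak _ (Real.sqrt_nonneg (2 / k))
    rw [Real.sq_sqrt (by positivity)] at this
    refine this.trans (le_of_eq ?_)
    field_simp; norm_num
  obtain ⟨t₁, ht₁, hat⟩ := intermediate_value_Icc' (Real.sqrt_nonneg (2 / k)) hac.continuousOn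
    (show ε ∈ Icc (a √(2 / k)) (a 0) from ⟨by linarith, by linarith⟩)
  have ht0 : 0 < t₁ := lt_of_le_of_ne ht₁.1 fun h => by rw [← h, ha0] at hat; linarith
  have hge : ∀ t ∈ Icc 0 t₁, ε ≤ a t := fun t ht => hat ▸ ham ht.1 ht₁.1 ht.2
  refine ⟨a, b, t₁, ht0, ht₁.2, ha0, hb0, hat, hge, ha, fun t ht => ?_⟩
  have := hb t
  rwa [max_eq_left (hge t ht)] at this

theorem contDiff_two_of_hasDerivAt {a b c : ℝ → ℝ} (ha : ∀ t, HasDerivAt a (b t) t)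
    (hb : ∀ t, HasDerivAt b (c t) t) (hc : Continuous c) : ContDiff ℝ 2 a ∧ ContDiff ℝ 1 b := by
  have hb1 : ContDiff ℝ 1 b := by
    rw [contDiff_one_iff_deriv]
    exact ⟨fun t => (hb t).differentiableAt,
      by rwa [show deriv b = c from funext fun t => (hb t).deriv]⟩
  refine ⟨?_, hb1⟩
  rw [show (2 : WithTop ℕ∞) = 1 + 1 by norm_num, contDiff_succ_iff_deriv]
  exact ⟨fun t => (ha t).differentiableAt, by simp,
    by rwa [show deriv a = b from funext fun t => (ha t).deriv]⟩

theorem contDiff_infty_scaleFactor {a b : ℝ → ℝ} {d : ℕ} {k : ℝ} (hpos : ∀ t, 0 < a t)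
    (ha : ∀ t, HasDerivAt a (b t) t) (hb : ∀ t, HasDerivAt b (-k / a t ^ d) t) :
    ContDiff ℝ ∞ a ∧ ContDiff ℝ ∞ b := by
  have hda : deriv a = b := funext fun t => (ha t).deriv
  have hdb : deriv b = fun t => -k / a t ^ d := funext fun t => (hb t).deriv
  have key : ∀ m : ℕ, ContDiff ℝ m a ∧ ContDiff ℝ m b := by
    intro m
    induction m with
    | zero =>
      simp only [Nat.cast_zero, contDiff_zero]
      exact ⟨continuous_iff_continuousAt.2 fun t => (ha t).continuousAt,
        continuous_iff_continuousAt.2 fun t => (hb t).continuousAt⟩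
    | succ m ih =>
      simp only [Nat.cast_succ, contDiff_succ_iff_deriv]
      refine ⟨⟨fun t => (ha t).differentiableAt, by simp, hda ▸ ih.2⟩,
        ⟨fun t => (hb t).differentiableAt, by simp, ?_⟩⟩
      rw [hdb]
      exact contDiff_const.div (ih.1.pow d) fun t => (pow_pos (hpos t) d).ne'
  exact ⟨contDiff_infty.2 fun m => (key m).1, contDiff_infty.2 fun m => (key m).2⟩

/-! ### The homogeneous solution -/

/-- Separated functions `g(t) r^j` lie in `C^k(I, D^s)` as soon as `g` is `C^k` on `I`. -/
theorem memCD_mul_pow {k s : ℕ∞} {I : Set ℝ} (hI : UniqueDiffOn ℝ I) {g : ℝ → ℝ}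
    (hg : ContDiffOn ℝ k g I) (j : ℕ) : MemCD k s I (fun t r => g t * r ^ j) := by
  refine ⟨fun r _ => hg.mul contDiffOn_const, fun i hi => ?_⟩
  have hgi : ContinuousOn (iteratedDerivWithin i g I) I :=
    hg.continuousOn_iteratedDerivWithin (by exact_mod_cast hi) hI
  simp only [iteratedDerivWithin_mul_const_field]
  refine ⟨?_, fun t _ => ⟨by fun_prop, ?_⟩, fun b _ => ?_⟩
  · exact (hgi.comp continuousOn_fst fun p hp => hp.1).mul (continuousOn_snd.pow j)
  · exact (contDiff_const.mul (contDiff_id.pow j)).contDiffOn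
  · simp only [iteratedDerivWithin_const_mul_field]
    have hp : ContDiffOn ℝ b (fun r : ℝ => r ^ j) (Ioi 0) := (contDiff_id.pow j).contDiffOn
    have hpb := hp.continuousOn_iteratedDerivWithin le_rfl (uniqueDiffOn_Ioi 0)
    exact (hgi.comp continuousOn_fst fun p hp => hp.1).mul
      (hpb.comp continuousOn_snd fun p hp => hp.2)

/-- The spatially constant density `ρc / aⁿ` carried by the scale factor `a`. -/
noncomputable def homogeneousDensity (n : ℕ) (ρc : ℝ) (a : ℝ → ℝ) (t _r : ℝ) : ℝ := ρc / a t ^ n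

/-- The Hubble-type velocity `(a'/a) r` of a uniformly expanding flow; `b` stands for `a'`. -/
noncomputable def hubbleVelocity (a b : ℝ → ℝ) (t r : ℝ) : ℝ := b t / a t * r

/-- The potential `ρ(t) r² / (2n)` of the homogeneous density `ρ(t) = ρc / a(t)ⁿ`, normalized to
vanish at the origin. -/
noncomputable def homogeneousPotential (n : ℕ) (ρc : ℝ) (a : ℝ → ℝ) (t r : ℝ) : ℝ :=
  ρc / a t ^ n / (2 * n) * r ^ 2

theorem memCD_homogeneousDensity {k s : ℕ∞} {I : Set ℝ} (hI : UniqueDiffOn ℝ I) (n : ℕ) (ρc : ℝ)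
    {a : ℝ → ℝ} (ha : ContDiffOn ℝ k a I) (hpos : ∀ t ∈ I, 0 < a t) :
    MemCD k s I (homogeneousDensity n ρc a) := by
  have := memCD_mul_pow (s := s) hI (g := fun t => ρc / a t ^ n)
    (contDiffOn_const.div (ha.pow n) fun t ht => (pow_pos (hpos t ht) n).ne') 0
  simpa only [pow_zero, mul_one] using! this

theorem memCD_hubbleVelocity {k s : ℕ∞} {I : Set ℝ} (hI : UniqueDiffOn ℝ I)
    {a b : ℝ → ℝ} (ha : ContDiffOn ℝ k a I) (hb : ContDiffOn ℝ k b I) (hpos : ∀ t ∈ I, 0 < a t) :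
    MemCD k s I (hubbleVelocity a b) := by
  have := memCD_mul_pow (s := s) hI (g := fun t => b t / a t)
    (hb.div ha fun t ht => (hpos t ht).ne') 1
  simpa only [pow_one] using! this

theorem memCD_homogeneousPotential {k s : ℕ∞} {I : Set ℝ} (hI : UniqueDiffOn ℝ I) (n : ℕ)
    (ρc : ℝ) {a : ℝ → ℝ} (ha : ContDiffOn ℝ k a I) (hpos : ∀ t ∈ I, 0 < a t) :
    MemCD k s I (homogeneousPotential n ρc a) :=
  memCD_mul_pow hI (g := fun t => ρc / a t ^ n / (2 * n))
    ((contDiffOn_const.div (ha.pow n) fun t ht => (pow_pos (hpos t ht) n).ne').div_const _) 2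

theorem hasDerivAt_homogeneousDensity {a b : ℝ → ℝ} {t : ℝ} (d : ℕ) (ρc : ℝ) (hpos : 0 < a t)
    (ha : HasDerivAt a (b t) t) :
    HasDerivAt (fun t => ρc / a t ^ (d + 1))
      (-((d + 1 : ℕ) : ℝ) * (ρc / a t ^ (d + 1)) * (b t / a t)) t := by
  convert! (hasDerivAt_const t ρc).div (ha.pow (d + 1)) (pow_pos hpos _).ne' using 1
  simp only [Pi.pow_apply, add_tsub_cancel_right]
  field_simp
  ring

/-- Riccati form of the scale factor equation for the Hubble rate `a'/a`. -/
theorem hasDerivAt_hubbleRate {a b : ℝ → ℝ} {t : ℝ} {d : ℕ} {k : ℝ} (hpos : 0 < a t)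
    (ha : HasDerivAt a (b t) t) (hb : HasDerivAt b (-k / a t ^ d) t) :
    HasDerivAt (fun t => b t / a t) (-(k / a t ^ (d + 1)) - (b t / a t) ^ 2) t := by
  convert! hb.div ha hpos.ne' using 1
  field_simp
  ring

theorem hasDerivAt_homogeneousPotential (n : ℕ) (ρc : ℝ) (a : ℝ → ℝ) (t r : ℝ) :
    HasDerivAt (homogeneousPotential n ρc a t) (ρc / a t ^ n / n * r) r := by
  have h := (hasDerivAt_pow 2 r).const_mul (ρc / a t ^ n / (2 * n))
  convert! h using 1
  simp
  ring

theorem mass_const (d : ℕ) (g : ℝ → ℝ) (t r : ℝ) :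
    mass (d + 1) (fun t _ => g t) t r = g t * (r ^ (d + 1) / (d + 1 : ℕ)) := by
  simp [mass]

theorem isRadialSolution_homogeneous (d : ℕ) (lam ρc : ℝ) {T : EReal} {a b : ℝ → ℝ}
    (hI : UniqueDiffOn ℝ (timeInterval T)) (hpos : ∀ t ∈ timeInterval T, 0 < a t)
    (ha0 : a 0 = 1) (hb0 : b 0 = 0) (ha : ∀ t ∈ timeInterval T, HasDerivAt a (b t) t)
    (hb : ∀ t ∈ timeInterval T, HasDerivAt b (-(lam * ρc / (d + 1 : ℕ)) / a t ^ d) t)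
    (ha2 : ContDiff ℝ 2 a) (hb1 : ContDiff ℝ 1 b) :
    IsRadialSolution (d + 1) lam (fun _ => ρc) (fun _ => 0) T (homogeneousDensity (d + 1) ρc a)
      (hubbleVelocity a b) (homogeneousPotential (d + 1) ρc a) where
  density_mem := memCD_homogeneousDensity hI _ _ ha2.contDiffOn hpos
  velocity_mem := memCD_hubbleVelocity hI (ha2.of_le (by norm_num)).contDiffOn
    hb1.contDiffOn hpos
  potential_mem := memCD_homogeneousPotential hI _ _ ha2.contDiffOn hpos
  mass_eq t ht r hr := by
    have hg := hasDerivAt_homogeneousDensity d ρc (hpos t ht) (ha t ht)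
    have h1 : ∀ τ x, mass (d + 1) (homogeneousDensity (d + 1) ρc a) τ x =
      ρc / a τ ^ (d + 1) * (x ^ (d + 1) / (d + 1 : ℕ)) := fun τ x => mass_const d _ τ x
    have h2 : HasDerivAt (fun x : ℝ => ρc / a t ^ (d + 1) * (x ^ (d + 1) / (d + 1 : ℕ)))
        (ρc / a t ^ (d + 1) * r ^ d) r := by
      convert! ((hasDerivAt_pow (d + 1) r).div_const ((d + 1 : ℕ) : ℝ)).const_mul
        (ρc / a t ^ (d + 1)) using 1
      simp only [add_tsub_cancel_right]; field_simp
    simp only [h1]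
    rw [(hg.mul_const _).hasDerivWithinAt.derivWithin (hI t ht), h2.deriv, hubbleVelocity]
    field_simp
    ring
  momentum_eq t ht r hr := by
    have hh := hasDerivAt_hubbleRate (hpos t ht) (ha t ht) (hb t ht)
    have h1 : HasDerivAt (hubbleVelocity a b t) (b t / a t) r := by
      simpa using! (hasDerivAt_id r).const_mul (b t / a t)
    have h3 := (hh.mul_const r).hasDerivWithinAt (s := timeInterval T)
    rw [h1.deriv, (hasDerivAt_homogeneousPotential _ _ _ _ _).deriv]
    simp only [hubbleVelocity]
    rw [h3.derivWithin (hI t ht)]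
    have := hpos t ht
    field_simp
    ring
  poisson_eq t ht r hr := by
    have h3 : (fun x => x ^ (d + 1 - 1) * deriv (homogeneousPotential (d + 1) ρc a t) x) =
        fun x => ρc / a t ^ (d + 1) / (d + 1 : ℕ) * x ^ (d + 1) := by
      ext x; rw [(hasDerivAt_homogeneousPotential _ _ _ _ _).deriv, add_tsub_cancel_right]; ring
    rw [h3, ((hasDerivAt_pow (d + 1) r).const_mul _).deriv, homogeneousDensity]
    field_simp
  density_init r _ := by simp [homogeneousDensity, ha0]
  velocity_init r _ := by simp [hubbleVelocity, hb0]

theorem continuityEquation_homogeneous (d : ℕ) (ρc : ℝ) {T : EReal} {a b : ℝ → ℝ}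
    (hI : UniqueDiffOn ℝ (timeInterval T)) (hpos : ∀ t ∈ timeInterval T, 0 < a t)
    (ha : ∀ t ∈ timeInterval T, HasDerivAt a (b t) t) :
    ContinuityEquation (d + 1) T (homogeneousDensity (d + 1) ρc a) (hubbleVelocity a b) := by
  intro t ht r hr
  have hg := hasDerivAt_homogeneousDensity d ρc (hpos t ht) (ha t ht)
  have h1 : (fun x => x ^ (d + 1 - 1) * homogeneousDensity (d + 1) ρc a t x *
      hubbleVelocity a b t x) =
      fun x => ρc / a t ^ (d + 1) * (b t / a t) * x ^ (d + 1) := by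
    ext x; simp only [homogeneousDensity, hubbleVelocity, add_tsub_cancel_right]; ring
  rw [h1, ((hasDerivAt_pow (d + 1) r).const_mul _).deriv]
  simp only [homogeneousDensity]
  rw [hg.hasDerivWithinAt.derivWithin (hI t ht)]
  simp only [add_tsub_cancel_right]
  ring

theorem timeInterval_top : timeInterval ⊤ = Ici 0 := by
  ext t; simp [timeInterval]

theorem timeInterval_coe (T : ℝ) : timeInterval T = Ico 0 T := by
  ext t; simp [timeInterval]

/-! ### Distributional formulation -/

section Divergence

variable {n : ℕ}

theorem continuous_fderiv_apply_of_contDiff_one {F : SpaceTime n → ℝ} (hF : ContDiff ℝ 1 F)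
    (v : SpaceTime n) : Continuous (fun p => fderiv ℝ F p v) :=
  (hF.continuous_fderiv one_ne_zero).clm_apply continuous_const

theorem integrable_fderiv_apply {F : SpaceTime n → ℝ} (hF : ContDiff ℝ 1 F)
    (hc : HasCompactSupport F) (v : SpaceTime n) : Integrable (fun p => fderiv ℝ F p v) :=
  (continuous_fderiv_apply_of_contDiff_one hF v).integrable_of_hasCompactSupport
    (hc.fderiv_apply (𝕜 := ℝ) v)

theorem integral_halfSpace_dx {F : SpaceTime n → ℝ} (hF : ContDiff ℝ 1 F)
    (hc : HasCompactSupport F) (i : Fin n) : ∫ p in halfSpace n, dx i F p = 0 := by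
  unfold dx halfSpace
  have hint := integrable_fderiv_apply hF hc (0, EuclideanSpace.single i 1)
  rw [Measure.volume_eq_prod] at hint ⊢
  rw [setIntegral_prod _ hint.integrableOn]
  simp only [Measure.restrict_univ]
  refine integral_eq_zero_of_ae (Eventually.of_forall fun t => ?_)
  have hemb : Topology.IsClosedEmbedding (fun x : EuclideanSpace ℝ (Fin n) => (t, x)) :=
    (Isometry.of_dist_eq fun x y => by simp [Prod.dist_eq]).isClosedEmbedding
  have hs : ContDiff ℝ 1 (fun x => F (t, x)) := hF.comp (contDiff_const.prodMk contDiff_id)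
  have hsc : HasCompactSupport (fun x => F (t, x)) := hc.comp_isClosedEmbedding hemb
  have hd : ∀ x, HasFDerivAt (fun x => F (t, x))
      ((fderiv ℝ F (t, x)).comp (ContinuousLinearMap.inr ℝ ℝ (EuclideanSpace ℝ (Fin n)))) x :=
    fun x => ((hF.differentiable one_ne_zero) (t, x)).hasFDerivAt.comp x
      (hasFDerivAt_prodMk_right t x)
  have hi : Integrable (fun x => fderiv ℝ (fun x => F (t, x)) x (EuclideanSpace.single i 1)) :=
    ((hs.continuous_fderiv one_ne_zero).clm_apply continuous_const).integrable_of_hasCompactSupport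
      (hsc.fderiv_apply (𝕜 := ℝ) _)
  -- Integration by parts against the constant function `1`.
  have := integral_mul_fderiv_eq_neg_fderiv_mul_of_integrable (μ := volume) (𝕜 := ℝ)
    (f := fun _ : EuclideanSpace ℝ (Fin n) => (1 : ℝ)) (g := fun x => F (t, x))
    (v := EuclideanSpace.single i 1) (by simp)
    (by simpa using hi) (by simpa using hs.continuous.integrable_of_hasCompactSupport hsc)
    (fun x _ => differentiableAt_const _)
    (fun x _ => (hd x).differentiableAt)
  simpa [(hd _).fderiv] using this

theorem integral_halfSpace_dt {F : SpaceTime n → ℝ} (hF : ContDiff ℝ 1 F)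
    (hc : HasCompactSupport F) : ∫ p in halfSpace n, dt F p = -∫ x, F (0, x) := by
  unfold dt halfSpace
  have hint := (integrable_fderiv_apply hF hc (1, 0)).integrableOn (s := Ici 0 ×ˢ univ)
  rw [Measure.volume_eq_prod] at hint ⊢
  rw [setIntegral_prod _ hint]
  rw [IntegrableOn, ← Measure.prod_restrict] at hint
  rw [integral_integral_swap hint]
  simp only [Measure.restrict_univ]
  rw [← integral_neg]
  refine integral_congr_ae (Eventually.of_forall fun x => ?_)
  have hemb : Topology.IsClosedEmbedding (fun t : ℝ => (t, x)) :=
    (Isometry.of_dist_eq fun s t => by simp [Prod.dist_eq]).isClosedEmbedding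
  have hs : ContDiff ℝ 1 (fun t => F (t, x)) := hF.comp (contDiff_id.prodMk contDiff_const)
  have hsc : HasCompactSupport (fun t => F (t, x)) := hc.comp_isClosedEmbedding hemb
  have hd : ∀ t, HasDerivAt (fun t => F (t, x)) (fderiv ℝ F (t, x) (1, 0)) t := fun t =>
    ((hF.differentiable one_ne_zero) (t, x)).hasFDerivAt.comp_hasDerivAt t
      ((hasDerivAt_id t).prodMk (hasDerivAt_const t x))
  have := hsc.integral_Ioi_deriv_eq hs 0
  simp only [(hd _).deriv] at this
  simpa only [integral_Ici_eq_integral_Ioi] using this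

/-- Divergence theorem on `[0,∞) × ℝⁿ`: only the boundary term at `t = 0` survives. -/
theorem integral_halfSpace_divergence {A : SpaceTime n → ℝ} {B : Fin n → SpaceTime n → ℝ}
    (hA : ContDiff ℝ 1 A) (hAc : HasCompactSupport A) (hB : ∀ i, ContDiff ℝ 1 (B i))
    (hBc : ∀ i, HasCompactSupport (B i)) :
    ∫ p in halfSpace n, (dt A p + ∑ i, dx i (B i) p) = -∫ x, A (0, x) := by
  have h1 : IntegrableOn (dt A) (halfSpace n) := (integrable_fderiv_apply hA hAc _).integrableOn
  have h2 : ∀ i ∈ Finset.univ, IntegrableOn (dx i (B i)) (halfSpace n) := fun i _ =>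
    (integrable_fderiv_apply (hB i) (hBc i) _).integrableOn
  rw [integral_add h1 (integrable_finsetSum _ h2), integral_halfSpace_dt hA hAc,
    integral_finsetSum _ h2]
  simp [integral_halfSpace_dx (hB _) (hBc _)]

theorem dt_mul {F G : SpaceTime n → ℝ} {p : SpaceTime n} (hF : DifferentiableAt ℝ F p)
    (hG : DifferentiableAt ℝ G p) : dt (fun p => F p * G p) p = dt F p * G p + F p * dt G p := by
  simp only [dt, fderiv_fun_mul hF hG]
  simp; ring

theorem dx_mul {F G : SpaceTime n → ℝ} {p : SpaceTime n} (i : Fin n)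
    (hF : DifferentiableAt ℝ F p) (hG : DifferentiableAt ℝ G p) :
    dx i (fun p => F p * G p) p = dx i F p * G p + F p * dx i G p := by
  simp only [dx, fderiv_fun_mul hF hG]
  simp; ring

theorem dx_sub {F G : SpaceTime n → ℝ} {p : SpaceTime n} (i : Fin n)
    (hF : DifferentiableAt ℝ F p) (hG : DifferentiableAt ℝ G p) :
    dx i (fun p => F p - G p) p = dx i F p - dx i G p := by
  simp only [dx, fderiv_fun_sub hF hG]
  simp

theorem dt_time {g : ℝ → ℝ} {g' : ℝ} {p : SpaceTime n} (hg : HasDerivAt g g' p.1) :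
    dt (fun p : SpaceTime n => g p.1) p = g' := by
  rw [dt, HasFDerivAt.fderiv (f := fun p : SpaceTime n => g p.1)
    (hg.hasFDerivAt.comp p hasFDerivAt_fst)]
  simp

theorem dx_time {g : ℝ → ℝ} {g' : ℝ} {p : SpaceTime n} (i : Fin n) (hg : HasDerivAt g g' p.1) :
    dx i (fun p : SpaceTime n => g p.1) p = 0 := by
  rw [dx, HasFDerivAt.fderiv (f := fun p : SpaceTime n => g p.1)
    (hg.hasFDerivAt.comp p hasFDerivAt_fst)]
  simp

theorem hasFDerivAt_coord (p : SpaceTime n) (i : Fin n) :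
    HasFDerivAt (fun p : SpaceTime n => p.2 i)
      ((EuclideanSpace.proj i : EuclideanSpace ℝ (Fin n) →L[ℝ] ℝ).comp
        (ContinuousLinearMap.snd ℝ ℝ (EuclideanSpace ℝ (Fin n)))) p :=
  ((EuclideanSpace.proj i : EuclideanSpace ℝ (Fin n) →L[ℝ] ℝ).comp
        (ContinuousLinearMap.snd ℝ ℝ (EuclideanSpace ℝ (Fin n)))).hasFDerivAt

theorem dt_coord (p : SpaceTime n) (i : Fin n) : dt (fun p : SpaceTime n => p.2 i) p = 0 := by
  rw [dt, (hasFDerivAt_coord p i).fderiv]; simp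

theorem dx_coord (p : SpaceTime n) (i j : Fin n) :
    dx j (fun p : SpaceTime n => p.2 i) p = if i = j then 1 else 0 := by
  rw [dx, (hasFDerivAt_coord p i).fderiv]
  simp

theorem dx_normSq (p : SpaceTime n) (i : Fin n) :
    dx i (fun p : SpaceTime n => ‖p.2‖ ^ 2) p = 2 * p.2 i := by
  rw [dx, HasFDerivAt.fderiv (f := fun p : SpaceTime n => ‖p.2‖ ^ 2)
    ((hasStrictFDerivAt_norm_sq p.2).hasFDerivAt.comp p hasFDerivAt_snd)]
  simp [EuclideanSpace.inner_single_right]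

theorem contDiff_coord (i : Fin n) : ContDiff ℝ 1 (fun p : SpaceTime n => p.2 i) :=
  ((EuclideanSpace.proj i : EuclideanSpace ℝ (Fin n) →L[ℝ] ℝ).comp
        (ContinuousLinearMap.snd ℝ ℝ (EuclideanSpace ℝ (Fin n)))).contDiff

theorem IsTest.contDiff_dx {φ : SpaceTime n → ℝ} (hφ : IsTest φ) (i : Fin n) :
    ContDiff ℝ 1 (dx i φ) :=
  (hφ.1.fderiv_right (m := 1) (by norm_cast)).clm_apply contDiff_const

end Divergence

/-- A linear velocity field `h(t) x` with density `g(t)` and potential `q(t) |x|²` solves the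
Euler–Poisson equations in the distribution sense, provided that `g`, `h`, `q` satisfy the ODEs
obtained by inserting them. Each weak identity is the divergence theorem applied to the fluxes
times the test function. -/
theorem isDistributionalSolution_homogeneous {n : ℕ} {lam : ℝ} {g h q g' h' : ℝ → ℝ}
    (hgs : ContDiff ℝ 1 g) (hhs : ContDiff ℝ 1 h) (hqs : ContDiff ℝ 1 q)
    (hg : ∀ t, HasDerivAt g (g' t) t) (hh : ∀ t, HasDerivAt h (h' t) t)
    (hcont : ∀ t, g' t + n * (g t * h t) = 0)
    (hmom : ∀ t, h' t + h t ^ 2 + 2 * lam * q t = 0) (hpois : ∀ t, 2 * n * q t = g t)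
    (h0 : h 0 = 0) :
    IsDistributionalSolution lam (fun p : SpaceTime n => g p.1) (fun p => h p.1 • p.2)
      (fun p => q p.1 * ‖p.2‖ ^ 2) := by
  have sg : ContDiff ℝ 1 (fun p : SpaceTime n => g p.1) := hgs.comp contDiff_fst
  have sh : ContDiff ℝ 1 (fun p : SpaceTime n => h p.1) := hhs.comp contDiff_fst
  have sq : ContDiff ℝ 1 (fun p : SpaceTime n => q p.1) := hqs.comp contDiff_fst
  have sN : ContDiff ℝ 1 (fun p : SpaceTime n => ‖p.2‖ ^ 2) := contDiff_snd.norm_sq ℝ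
  have su : ∀ i, ContDiff ℝ 1 (fun p : SpaceTime n => h p.1 * p.2 i) := fun i =>
    sh.mul (contDiff_coord i)
  have sP := sq.mul sN
  have dq : ∀ t, HasDerivAt q (deriv q t) t := fun t =>
    (hqs.differentiable one_ne_zero t).hasDerivAt
  have D : ∀ {F : SpaceTime n → ℝ}, ContDiff ℝ 1 F → ∀ p, DifferentiableAt ℝ F p :=
    fun hF p => hF.differentiable one_ne_zero p
  have duj : ∀ i j p, dx j (fun p : SpaceTime n => h p.1 * p.2 i) p =
      if i = j then h p.1 else 0 := fun i j p => by
    rw [dx_mul j (D sh p) (D (contDiff_coord i) p), dx_time j (hh p.1), dx_coord]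
    simp
  have dut : ∀ i p, dt (fun p : SpaceTime n => h p.1 * p.2 i) p = h' p.1 * p.2 i := fun i p => by
    rw [dt_mul (D sh p) (D (contDiff_coord i) p), dt_time (hh p.1), dt_coord]
    simp
  have dP : ∀ i p, dx i (fun p : SpaceTime n => q p.1 * ‖p.2‖ ^ 2) p = 2 * q p.1 * p.2 i :=
    fun i p => by
      rw [dx_mul i (D sq p) (D sN p), dx_time i (dq p.1), dx_normSq]
      ring
  have L : ∀ {F : SpaceTime n → ℝ}, Continuous F → LocallyIntegrableOn F (halfSpace n) :=
    fun hF => hF.locallyIntegrable.locallyIntegrableOn _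
  refine
    { density_int := L sg.continuous
      density_init_int :=
        (continuous_const (y := g 0)).locallyIntegrable
      velocity_int := fun i => L (su i).continuous
      velocity_init_int := fun i => ?_
      potential_int := L sP.continuous
      flux_int := fun i => L (sg.continuous.mul (su i).continuous)
      continuity_eq := fun φ hφ => ?_
      momentum_eq := ⟨fun i j p => if i = j then h p.1 else 0, fun i j => ⟨L ?_, fun φ hφ => ?_⟩,
        fun i j => L ((su j).continuous.mul ?_), fun i φ hφ => ?_⟩
      poisson_eq := fun φ hφ => ?_ }
  · simp only [h0, zero_smul]
    exact continuous_const.locallyIntegrable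
  · have sφ : ContDiff ℝ 1 φ := hφ.1.of_le (by norm_cast)
    have hdiv := integral_halfSpace_divergence (A := fun p => g p.1 * φ p)
      (B := fun i p => g p.1 * (h p.1 * p.2 i) * φ p) (sg.mul sφ) hφ.2.mul_left
      (fun i => (sg.mul (su i)).mul sφ) (fun i => hφ.2.mul_left)
    rw [← neg_eq_iff_eq_neg] at hdiv
    rw [← hdiv, add_neg_eq_zero]
    congr 1
    ext p
    rw [dt_mul (D sg p) (D sφ p), dt_time (hg p.1)]
    have : ∀ i, dx i (fun p : SpaceTime n => g p.1 * (h p.1 * p.2 i) * φ p) p =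
        g p.1 * h p.1 * φ p + g p.1 * (h p.1 * p.2 i) * dx i φ p := fun i => by
      rw [dx_mul i (D (sg.mul (su i)) p) (D sφ p), dx_mul i (D sg p) (D (su i) p), duj,
        dx_time i (hg p.1)]
      simp
    simp only [this, Finset.sum_add_distrib, Finset.sum_const, Finset.card_univ, Fintype.card_fin,
      nsmul_eq_mul, PiLp.smul_apply, smul_eq_mul]
    linear_combination (-φ p) * hcont p.1
  · dsimp only
    split_ifs
    exacts [sh.continuous, continuous_const]
  · have sφ : ContDiff ℝ 1 φ := hφ.1.of_le (by norm_cast)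
    have h1 := integral_halfSpace_dx ((su i).mul sφ) hφ.2.mul_left j
    have h2 : ∀ p, dx j (fun p : SpaceTime n => h p.1 * p.2 i * φ p) p =
        (if i = j then h p.1 else 0) * φ p + h p.1 * p.2 i * dx j φ p := fun p => by
      rw [dx_mul j (D (su i) p) (D sφ p), duj]
    simp only [h2] at h1
    rw [integral_add, ← eq_neg_iff_add_eq_zero] at h1
    · exact h1
    · refine (Continuous.integrable_of_hasCompactSupport ?_ hφ.2.mul_left).integrableOn
      refine Continuous.mul ?_ sφ.continuous
      split_ifs
      exacts [sh.continuous, continuous_const]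
    · exact (((su i).continuous.mul (continuous_fderiv_apply_of_contDiff_one sφ _)
        ).integrable_of_hasCompactSupport (hφ.2.fderiv_apply (𝕜 := ℝ) _).mul_left).integrableOn
  · dsimp only
    split_ifs
    exacts [sh.continuous, continuous_const]
  · have sφ : ContDiff ℝ 1 φ := hφ.1.of_le (by norm_cast)
    have h1 := integral_halfSpace_dt ((su i).mul sφ) hφ.2.mul_left
    have h2 := integral_halfSpace_dx (contDiff_const (c := lam) |>.mul (sP.mul sφ))
      (hφ.2.mul_left.mul_left) i
    simp only [h0, zero_smul, PiLp.zero_apply, zero_mul, integral_zero, neg_zero, add_zero] at h1 ⊢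
    have i1 : IntegrableOn (dt fun p => h p.1 * p.2 i * φ p) (halfSpace n) :=
      (integrable_fderiv_apply ((su i).mul sφ) hφ.2.mul_left _).integrableOn
    have i2 : IntegrableOn (dx i fun p => lam * (q p.1 * ‖p.2‖ ^ 2 * φ p)) (halfSpace n) :=
      (integrable_fderiv_apply (contDiff_const (c := lam) |>.mul (sP.mul sφ))
        (hφ.2.mul_left.mul_left) _).integrableOn
    refine Eq.trans ?_ ((integral_add i1 i2).trans (by rw [h1, h2, add_zero]))
    congr 1
    ext p
    rw [dt_mul (D (su i) p) (D sφ p), dut, dx_mul i (D contDiff_const p) (D (sP.mul sφ) p),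
      dx_mul i (D sP p) (D sφ p), dP]
    simp only [dx, fderiv_fun_const, PiLp.smul_apply, smul_eq_mul, mul_ite, mul_zero,
      Finset.sum_ite_eq, Finset.mem_univ, if_true, Pi.zero_apply, zero_apply]
    linear_combination (-(p.2 i) * φ p) * hmom p.1
  · have sφ : ContDiff ℝ 1 φ := hφ.1.of_le (by norm_cast)
    have sx := hφ.contDiff_dx
    have cx : ∀ i, HasCompactSupport (dx i φ) := fun i => hφ.2.fderiv_apply (𝕜 := ℝ) _
    have s1 : ∀ i, ContDiff ℝ 1 (fun p : SpaceTime n => 2 * q p.1 * p.2 i) := fun i =>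
      (contDiff_const.mul sq).mul (contDiff_coord i)
    have hdiv := integral_halfSpace_divergence (A := fun p => 0)
      (B := fun i p => q p.1 * ‖p.2‖ ^ 2 * dx i φ p - 2 * q p.1 * p.2 i * φ p) contDiff_const
      HasCompactSupport.zero (fun i => (sP.mul (sx i)).sub ((s1 i).mul sφ))
      (fun i => (cx i).mul_left.sub hφ.2.mul_left)
    simp only [integral_zero, neg_zero] at hdiv
    rw [← sub_eq_zero, ← integral_sub, ← hdiv]
    · congr 1
      ext p
      have h1 : ∀ i, dx i (fun p : SpaceTime n => 2 * q p.1 * p.2 i) p = 2 * q p.1 := fun i => by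
        rw [dx_mul i (D (contDiff_const.mul sq) p) (D (contDiff_coord i) p), dx_coord,
          dx_time (g := fun t => 2 * q t) i ((dq p.1).const_mul 2)]
        simp
      have : ∀ i, dx i (fun p : SpaceTime n =>
          q p.1 * ‖p.2‖ ^ 2 * dx i φ p - 2 * q p.1 * p.2 i * φ p) p =
          q p.1 * ‖p.2‖ ^ 2 * dx i (dx i φ) p - 2 * q p.1 * φ p := fun i => by
        rw [dx_sub i (D (sP.mul (sx i)) p) (D ((s1 i).mul sφ) p), dx_mul i (D sP p) (D (sx i) p),
          dx_mul i (D (s1 i) p) (D sφ p), dP, h1]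
        ring
      simp only [this, Finset.sum_sub_distrib, Finset.sum_const, Finset.card_univ,
        Fintype.card_fin, nsmul_eq_mul, ← Finset.mul_sum, ← hpois]
      simp [dt]
      ring
    · refine (Continuous.integrable_of_hasCompactSupport ?_ ?_).integrableOn
      · exact sP.continuous.mul (continuous_finsetSum _ fun i _ =>
          continuous_fderiv_apply_of_contDiff_one (sx i) _)
      · have : ∀ s : Finset (Fin n), HasCompactSupport (fun p => ∑ i ∈ s, dx i (dx i φ) p) := by
          intro s
          induction s using Finset.induction_on with
          | empty => simpa using! HasCompactSupport.zero
          | insert i s hi ih =>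
            simp only [Finset.sum_insert hi]
            exact ((cx i).fderiv_apply (𝕜 := ℝ) _).add ih
        exact (this _).mul_left
    · exact ((sg.mul sφ).continuous.integrable_of_hasCompactSupport hφ.2.mul_left).integrableOn

/-! ### Functions of time and radius -/

theorem MemCD.continuousOn_zero {k s : ℕ∞} {I : Set ℝ} {f : ℝ → ℝ → ℝ} (hf : MemCD k s I f) :
    ContinuousOn (fun p : ℝ × ℝ => f p.1 p.2) (I ×ˢ Ici 0) := by
  simpa using (hf.2 0 (by simp)).1

theorem MemCD.continuousOn_space {k s : ℕ∞} {I : Set ℝ} {f : ℝ → ℝ → ℝ} (hf : MemCD k s I f)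
    {t : ℝ} (ht : t ∈ I) : ContinuousOn (f t) (Ici 0) :=
  hf.continuousOn_zero.comp (f := fun r => (t, r)) (by fun_prop) fun _ hr => ⟨ht, hr⟩

theorem MemCD.contDiffOn_space {k s : ℕ∞} {I : Set ℝ} {f : ℝ → ℝ → ℝ} (hf : MemCD k s I f)
    {t : ℝ} (ht : t ∈ I) : ContDiffOn ℝ s (f t) (Ioi 0) := by
  simpa using ((hf.2 0 (by simp)).2.1 t ht).2

theorem MemCD.hasDerivAt_space {k s : ℕ∞} {I : Set ℝ} {f : ℝ → ℝ → ℝ} (hf : MemCD k s I f)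
    (hs : 1 ≤ s) {t : ℝ} (ht : t ∈ I) {r : ℝ} (hr : 0 < r) :
    HasDerivAt (f t) (deriv (f t) r) r :=
  (((hf.contDiffOn_space ht).differentiableOn
    (by simpa using (zero_lt_one.trans_le hs).ne')).differentiableAt (Ioi_mem_nhds hr)).hasDerivAt

theorem MemCD.continuousOn_deriv_space {k s : ℕ∞} {I : Set ℝ} {f : ℝ → ℝ → ℝ}
    (hf : MemCD k s I f) (hs : 1 ≤ s) :
    ContinuousOn (fun p : ℝ × ℝ => deriv (f p.1) p.2) (I ×ˢ Ioi 0) := by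
  refine ((hf.2 0 (by simp)).2.2 1 (by simpa using hs)).congr fun p hp => ?_
  simp only [iteratedDerivWithin_zero, iteratedDerivWithin_one]
  exact (derivWithin_of_isOpen isOpen_Ioi hp.2).symm

theorem MemCD.continuousOn_derivWithin_time {k s : ℕ∞} {I : Set ℝ} {f : ℝ → ℝ → ℝ}
    (hf : MemCD k s I f) (hk : 1 ≤ k) :
    ContinuousOn (fun p : ℝ × ℝ => derivWithin (fun τ => f τ p.2) I p.1) (I ×ˢ Ici 0) := by
  simpa [iteratedDerivWithin_one] using (hf.2 1 (by simpa using hk)).1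

theorem MemCD.hasDerivAt_time {k s : ℕ∞} {f : ℝ → ℝ → ℝ} (hf : MemCD k s (Ici 0) f)
    (hk : 1 ≤ k) {t : ℝ} (ht : 0 < t) {r : ℝ} (hr : 0 ≤ r) :
    HasDerivAt (fun τ => f τ r) (derivWithin (fun τ => f τ r) (Ici 0) t) t :=
  (((hf.1 r hr).differentiableOn
    (by simpa using (zero_lt_one.trans_le hk).ne')) t ht.le).hasDerivWithinAt.hasDerivAt
      (Ici_mem_nhds ht)

/-- A function that is continuous on the closed quadrant extends continuously to the plane. -/
theorem exists_continuous_extension {g : ℝ → ℝ → ℝ}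
    (hg : ContinuousOn (fun p : ℝ × ℝ => g p.1 p.2) (Ici 0 ×ˢ Ici 0)) :
    ∃ G : ℝ → ℝ → ℝ, Continuous G.uncurry ∧ ∀ t, 0 ≤ t → ∀ s, 0 ≤ s → G t s = g t s := by
  refine ⟨fun t s => g (max t 0) (max s 0), ?_, fun t ht s hs => by
    simp only [max_eq_left ht, max_eq_left hs]⟩
  exact hg.comp_continuous (f := fun p : ℝ × ℝ => (max p.1 0, max p.2 0)) (by fun_prop)
    fun p => ⟨le_max_right p.1 0, le_max_right p.2 0⟩

theorem mass_congr {d : ℕ} {g h : ℝ → ℝ → ℝ} {t r : ℝ} (hr : 0 ≤ r)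
    (hgh : ∀ s, 0 ≤ s → g t s = h t s) : mass (d + 1) g t r = mass (d + 1) h t r := by
  refine intervalIntegral.integral_congr fun s hs => ?_
  rw [uIcc_of_le hr] at hs
  simp only [hgh s hs.1]

theorem continuousOn_mass {d : ℕ} {g : ℝ → ℝ → ℝ}
    (hg : ContinuousOn (fun p : ℝ × ℝ => g p.1 p.2) (Ici 0 ×ˢ Ici 0)) :
    ContinuousOn (fun p : ℝ × ℝ => mass (d + 1) g p.1 p.2) (Ici 0 ×ˢ Ici 0) := by
  obtain ⟨G, hG, hGg⟩ := exists_continuous_extension hg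
  have : Continuous (fun p : ℝ × ℝ => ∫ s in (0 : ℝ)..p.2, G p.1 s * s ^ d) :=
    intervalIntegral.continuous_parametric_primitive_of_continuous
      (f := fun t s => G t s * s ^ d) (hG.mul (by fun_prop : Continuous fun p : ℝ × ℝ => p.2 ^ d))
  refine this.continuousOn.congr fun p hp => ?_
  exact mass_congr hp.2 fun s hs => (hGg p.1 hp.1 s hs).symm

theorem hasDerivAt_mass_space {d : ℕ} {g : ℝ → ℝ → ℝ} {t r : ℝ}
    (hg : ContinuousOn (g t) (Ici 0)) (hr : 0 < r) :
    HasDerivAt (fun x => mass (d + 1) g t x) (g t r * r ^ d) r := by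
  have hc : ContinuousOn (fun s => g t s * s ^ (d + 1 - 1)) (Ici 0) := hg.mul (by fun_prop)
  have hat : ContinuousAt (fun s => g t s * s ^ (d + 1 - 1)) r := hc.continuousAt (Ici_mem_nhds hr)
  refine intervalIntegral.integral_hasDerivAt_right ?_ ?_ hat
  · exact (hc.mono (by rw [uIcc_of_le hr.le]; exact Icc_subset_Ici_self)).intervalIntegrable
  · exact (hc.mono Ioi_subset_Ici_self).stronglyMeasurableAtFilter isOpen_Ioi r hr

theorem hasDerivAt_mass_time {d : ℕ} {ρ : ℝ → ℝ → ℝ} (hρ : MemCD 2 0 (Ici 0) ρ) {t r : ℝ}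
    (ht : 0 < t) (hr : 0 ≤ r) :
    HasDerivAt (fun τ => mass (d + 1) ρ τ r)
      (mass (d + 1) (fun τ s => derivWithin (fun τ => ρ τ s) (Ici 0) τ) t r) t := by
  obtain ⟨G, hG, hGg⟩ := exists_continuous_extension hρ.continuousOn_zero
  obtain ⟨D, hD, hDg⟩ := exists_continuous_extension
    (g := fun τ s => derivWithin (fun τ => ρ τ s) (Ici 0) τ)
    (hρ.continuousOn_derivWithin_time (by norm_num))
  have hDer : ∀ τ, 0 < τ → ∀ s, 0 ≤ s → HasDerivAt (fun τ => G τ s) (D τ s) τ := by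
    intro τ hτ s hs
    rw [hDg τ hτ.le s hs]
    refine (hρ.hasDerivAt_time (by norm_num) hτ hs).congr_of_eventuallyEq ?_
    filter_upwards [Ioi_mem_nhds hτ] with u hu using hGg u (le_of_lt hu) s hs
  have hG1 : Continuous (fun p : ℝ × ℝ => G p.1 p.2 * p.2 ^ d) := hG.mul (by fun_prop)
  have hD1 : Continuous (fun p : ℝ × ℝ => D p.1 p.2 * p.2 ^ d) := hD.mul (by fun_prop)
  have hGs : ∀ τ, Continuous fun s => G τ s * s ^ d := fun τ =>
    hG1.comp (by fun_prop : Continuous fun s : ℝ => (τ, s))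
  have hDs : ∀ τ, Continuous fun s => D τ s * s ^ d := fun τ =>
    hD1.comp (by fun_prop : Continuous fun s : ℝ => (τ, s))
  obtain ⟨B, hB⟩ := (isCompact_Icc.prod isCompact_Icc : IsCompact
    (Icc (t / 2) (t + 1) ×ˢ Icc 0 r)).exists_bound_of_continuousOn hD1.continuousOn
  have key := (intervalIntegral.hasDerivAt_integral_of_dominated_loc_of_deriv_le
    (μ := volume) (a := 0) (b := r)
    (F := fun τ s => G τ s * s ^ d) (F' := fun τ s => D τ s * s ^ d) (x₀ := t)
    (s := Icc (t / 2) (t + 1)) (bound := fun _ => B) (Icc_mem_nhds (by linarith) (by linarith))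
    (Eventually.of_forall fun τ => (hGs τ).aestronglyMeasurable)
    ((hGs t).intervalIntegrable _ _) (hDs t).aestronglyMeasurable
    (Eventually.of_forall fun s hs τ hτ => by
      rw [uIoc_of_le hr] at hs
      exact hB (τ, s) ⟨hτ, Ioc_subset_Icc_self hs⟩)
    intervalIntegrable_const
    (Eventually.of_forall fun s hs τ hτ => by
      rw [uIoc_of_le hr] at hs
      exact (hDer τ (by linarith [hτ.1]) s hs.1.le).mul_const _)).2
  have e : mass (d + 1) (fun τ s => derivWithin (fun τ => ρ τ s) (Ici 0) τ) t r =
      ∫ s in (0 : ℝ)..r, D t s * s ^ d :=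
    mass_congr hr fun s hs => (hDg t ht.le s hs).symm
  rw [e]
  refine key.congr_of_eventuallyEq ?_
  filter_upwards [Ioi_mem_nhds ht] with u hu
  exact mass_congr hr fun s hs => (hGg u (le_of_lt hu) s hs).symm

/-- Chain rule along the curve `(t, γ t)` from continuous partial derivatives. -/
theorem hasDerivAt_along_curve {f f₁ f₂ : ℝ → ℝ → ℝ} {γ : ℝ → ℝ} {γ' t : ℝ} {U : Set (ℝ × ℝ)}
    (hU : IsOpen U) (h₁ : ∀ p ∈ U, HasDerivAt (fun τ => f τ p.2) (f₁ p.1 p.2) p.1)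
    (h₂ : ∀ p ∈ U, HasDerivAt (f p.1) (f₂ p.1 p.2) p.2)
    (c₁ : ContinuousOn (fun p : ℝ × ℝ => f₁ p.1 p.2) U)
    (c₂ : ContinuousOn (fun p : ℝ × ℝ => f₂ p.1 p.2) U) (hγ : HasDerivAt γ γ' t)
    (ht : (t, γ t) ∈ U) :
    HasDerivAt (fun τ => f τ (γ τ)) (f₁ t (γ t) + γ' * f₂ t (γ t)) t := by
  have hn := hU.mem_nhds ht
  have h := hasStrictFDerivAt_uncurry_coprod (𝕜 := ℝ) (u := (t, γ t)) (f := f)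
    (f₁ := fun x y => ContinuousLinearMap.toSpanSingleton ℝ (f₁ x y))
    (f₂ := fun x y => ContinuousLinearMap.toSpanSingleton ℝ (f₂ x y))
    (by filter_upwards [hn] with p hp using (h₁ p hp).hasFDerivAt)
    (by filter_upwards [hn] with p hp using (h₂ p hp).hasFDerivAt)
    ((ContinuousLinearMap.toSpanSingletonCLE (𝕜 := ℝ) (E := ℝ)).continuous.continuousAt.comp
      (c₁.continuousAt hn))
    ((ContinuousLinearMap.toSpanSingletonCLE (𝕜 := ℝ) (E := ℝ)).continuous.continuousAt.comp
      (c₂.continuousAt hn))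
  have := h.hasFDerivAt.comp_hasDerivAt t ((hasDerivAt_id t).prodMk hγ)
  simpa [Function.comp_def, Function.HasUncurry.uncurry] using this

/-- Grönwall for a linear `2 × 2` system that is only assumed to hold in the interior: the energy
`w² + m²` times a decaying exponential is antitone. -/
theorem eq_zero_of_linear_system {w m α β γ : ℝ → ℝ} {T : ℝ} (hT : 0 ≤ T)
    (hw : ContinuousOn w (Icc 0 T)) (hm : ContinuousOn m (Icc 0 T))
    (hα : ContinuousOn α (Icc 0 T)) (hβ : ContinuousOn β (Icc 0 T)) (hγ : ContinuousOn γ (Icc 0 T))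
    (hw' : ∀ t ∈ Ioo 0 T, HasDerivAt w (α t * w t + β t * m t) t)
    (hm' : ∀ t ∈ Ioo 0 T, HasDerivAt m (γ t * w t) t) (hw0 : w 0 = 0) (hm0 : m 0 = 0) :
    ∀ t ∈ Icc 0 T, w t = 0 ∧ m t = 0 := by
  obtain ⟨A, hA⟩ := isCompact_Icc.exists_bound_of_continuousOn hα
  obtain ⟨B, hB⟩ := isCompact_Icc.exists_bound_of_continuousOn (hβ.add hγ)
  have hB0 : 0 ≤ B := (norm_nonneg _).trans (hB 0 ⟨le_rfl, hT⟩)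
  have hA0 : 0 ≤ A := (norm_nonneg _).trans (hA 0 ⟨le_rfl, hT⟩)
  set K := 2 * A + B with hK
  have hanti : AntitoneOn (fun t => (w t ^ 2 + m t ^ 2) * Real.exp (-K * t)) (Icc 0 T) := by
    refine antitoneOn_of_hasDerivWithinAt_nonpos (convex_Icc 0 T)
      (f' := fun t => (2 * w t * (α t * w t + β t * m t) + 2 * m t * (γ t * w t)) *
        Real.exp (-K * t) + (w t ^ 2 + m t ^ 2) * (Real.exp (-K * t) * -K))
      (((hw.pow 2).add (hm.pow 2)).mul (by fun_prop)) (fun t ht => ?_) fun t ht => ?_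
    · rw [interior_Icc] at ht
      have h1 := ((hw' t ht).pow 2).add ((hm' t ht).pow 2)
      have h2 : HasDerivAt (fun t => Real.exp (-K * t)) (Real.exp (-K * t) * -K) t := by
        simpa using ((hasDerivAt_id t).const_mul (-K)).exp
      convert! (h1.mul h2).hasDerivWithinAt using 1
      simp
    · rw [interior_Icc] at ht
      have e := Real.exp_pos (-K * t)
      have h1 := abs_le.1 (hA t (Ioo_subset_Icc_self ht))
      have h2 := abs_le.1 (hB t (Ioo_subset_Icc_self ht))
      rw [Pi.add_apply] at h2
      have h3 : 2 * α t * w t ^ 2 ≤ 2 * A * w t ^ 2 := by nlinarith [sq_nonneg (w t)]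
      have h4 : 2 * (β t + γ t) * (w t * m t) ≤ B * (w t ^ 2 + m t ^ 2) := by
        have p1 := mul_nonneg (sub_nonneg.2 h2.2) (sq_nonneg (w t + m t))
        have p2 := mul_nonneg (neg_le_iff_add_nonneg.1 h2.1) (sq_nonneg (w t - m t))
        nlinarith
      have h5 : 0 ≤ 2 * A * m t ^ 2 := by positivity
      have : (2 * w t * (α t * w t + β t * m t) + 2 * m t * (γ t * w t))
          - K * (w t ^ 2 + m t ^ 2) ≤ 0 := by rw [hK]; nlinarith
      nlinarith
  intro t ht
  have := hanti ⟨le_rfl, hT⟩ ht ht.1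
  simp only [hw0, hm0, zero_pow two_ne_zero, add_zero, zero_mul] at this
  have h0 : w t ^ 2 + m t ^ 2 ≤ 0 := by
    have e := Real.exp_pos (-K * t)
    by_contra hcon
    push Not at hcon
    have := mul_pos hcon e
    linarith
  constructor <;> nlinarith [sq_nonneg (w t), sq_nonneg (m t)]

/-! ### Uniqueness of global solutions -/

namespace IsRadialSolution

variable {d : ℕ} {lam : ℝ} {ρ₀ v₀ : ℝ → ℝ} {ρ v Φ : ℝ → ℝ → ℝ}

theorem memCD_density (S : IsRadialSolution (d + 1) lam ρ₀ v₀ ⊤ ρ v Φ) : MemCD 2 0 (Ici 0) ρ :=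
  timeInterval_top ▸ S.density_mem

theorem memCD_velocity (S : IsRadialSolution (d + 1) lam ρ₀ v₀ ⊤ ρ v Φ) : MemCD 1 1 (Ici 0) v :=
  timeInterval_top ▸ S.velocity_mem

theorem memCD_potential (S : IsRadialSolution (d + 1) lam ρ₀ v₀ ⊤ ρ v Φ) : MemCD 2 2 (Ici 0) Φ :=
  timeInterval_top ▸ S.potential_mem

/-- Conservation of mass, with the time derivative taken under the integral. -/
theorem mass_time (S : IsRadialSolution (d + 1) lam ρ₀ v₀ ⊤ ρ v Φ) {t r : ℝ} (ht : 0 < t)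
    (hr : 0 < r) :
    mass (d + 1) (fun τ s => derivWithin (fun τ => ρ τ s) (Ici 0) τ) t r =
      -(v t r * (ρ t r * r ^ d)) := by
  have h := S.mass_eq t (by rw [timeInterval_top]; exact ht.le) r hr
  rw [timeInterval_top, (hasDerivAt_mass_time S.memCD_density ht hr.le).hasDerivWithinAt.derivWithin
    (uniqueDiffOn_Ici 0 t ht.le),
    (hasDerivAt_mass_space (S.memCD_density.continuousOn_space ht.le) hr).deriv] at h
  linarith

theorem momentum (S : IsRadialSolution (d + 1) lam ρ₀ v₀ ⊤ ρ v Φ) {t r : ℝ} (ht : 0 ≤ t)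
    (hr : 0 < r) :
    derivWithin (fun τ => v τ r) (Ici 0) t + v t r * deriv (v t) r + lam * deriv (Φ t) r = 0 := by
  have h := S.momentum_eq t (by rwa [timeInterval_top]) r hr
  rwa [timeInterval_top] at h

/-- Poisson's equation, integrated once. The constant `C` is the point mass at the centre. -/
theorem exists_flux_eq_mass_add (S : IsRadialSolution (d + 1) lam ρ₀ v₀ ⊤ ρ v Φ) {t : ℝ}
    (ht : 0 ≤ t) : ∃ C, ∀ r, 0 < r → r ^ d * deriv (Φ t) r = mass (d + 1) ρ t r + C := by
  have hΦ : ContDiffOn ℝ 2 (Φ t) (Ioi 0) := S.memCD_potential.contDiffOn_space ht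
  have hd : ∀ r, 0 < r → DifferentiableAt ℝ (deriv (Φ t)) r := fun r hr =>
    ((hΦ.deriv_of_isOpen (m := 1) isOpen_Ioi (by norm_num)).differentiableOn
      one_ne_zero).differentiableAt (Ioi_mem_nhds hr)
  have hm : ∀ r, 0 < r → HasDerivAt (fun x => mass (d + 1) ρ t x) (ρ t r * r ^ d) r :=
    fun r hr => hasDerivAt_mass_space (S.memCD_density.continuousOn_space ht) hr
  have hder : ∀ r ∈ Ioi (0 : ℝ),
      HasDerivAt (fun x => x ^ d * deriv (Φ t) x - mass (d + 1) ρ t x) 0 r := by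
    intro r hr
    have h1 : DifferentiableAt ℝ (fun x => x ^ d * deriv (Φ t) x) r :=
      (differentiableAt_id.pow d).mul (hd r hr)
    have h2 := S.poisson_eq t (by rwa [timeInterval_top]) r hr
    simp only [add_tsub_cancel_right] at h2
    convert! h1.hasDerivAt.sub (hm r hr) using 1
    rw [h2]; ring
  refine ⟨1 ^ d * deriv (Φ t) 1 - mass (d + 1) ρ t 1, fun r hr => ?_⟩
  have := isOpen_Ioi.is_const_of_deriv_eq_zero isPreconnected_Ioi
    (fun x hx => (hder x hx).differentiableAt.differentiableWithinAt)
    (fun x hx => (hder x hx).deriv) (show r ∈ Ioi (0 : ℝ) from hr) 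
    (mem_Ioi.2 (one_pos : (0 : ℝ) < 1))
  linarith

/-- Where the central density is positive, `m_t = O(r^(d+1))` and conservation of mass give
`v = O(r)`. -/
theorem exists_abs_velocity_le (S : IsRadialSolution (d + 1) lam ρ₀ v₀ ⊤ ρ v Φ) {t : ℝ}
    (ht : 0 < t) (hρ : 0 < ρ t 0) : ∃ K, ∀ᶠ r in 𝓝[>] (0 : ℝ), |v t r| ≤ K * r := by
  have hD : ContinuousOn (fun s => derivWithin (fun τ => ρ τ s) (Ici 0) t) (Ici 0) :=
    (S.memCD_density.continuousOn_derivWithin_time (by norm_num)).comp (f := fun s => (t, s))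
      (by fun_prop) fun s hs => ⟨ht.le, hs⟩
  obtain ⟨L, hL⟩ := (isCompact_Icc (a := (0 : ℝ)) (b := 1)).exists_bound_of_continuousOn
    (hD.mono Icc_subset_Ici_self)
  have hρc : Tendsto (ρ t) (𝓝[>] 0) (𝓝 (ρ t 0)) :=
    ((S.memCD_density.continuousOn_space ht.le) 0 self_mem_Ici).mono_left
      (nhdsWithin_mono _ Ioi_subset_Ici_self)
  refine ⟨2 * L / ρ t 0, ?_⟩
  filter_upwards [hρc.eventually (lt_mem_nhds (half_lt_self hρ)), Ioo_mem_nhdsGT one_pos]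
    with r h1 hr
  have hmt := S.mass_time ht hr.1
  have hb : |mass (d + 1) (fun τ s => derivWithin (fun τ => ρ τ s) (Ici 0) τ) t r| ≤
      L * r ^ d * |r - 0| := by
    refine intervalIntegral.norm_integral_le_of_norm_le_const (E := ℝ) fun s hs => ?_
    rw [uIoc_of_le hr.1.le] at hs
    rw [norm_mul, add_tsub_cancel_right, norm_pow, Real.norm_of_nonneg hs.1.le]
    exact mul_le_mul (hL s ⟨hs.1.le, hs.2.trans hr.2.le⟩) (pow_le_pow_left₀ hs.1.le hs.2 d)
      (pow_nonneg hs.1.le d) ((norm_nonneg _).trans (hL 0 ⟨le_rfl, zero_le_one⟩))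
  have hrd : 0 < r ^ d := pow_pos hr.1 d
  rw [hmt, abs_neg, abs_mul, abs_mul, abs_of_pos hrd, abs_of_pos ((half_pos hρ).trans h1), sub_zero,
    abs_of_pos hr.1] at hb
  have h2 : |v t r| * ρ t r ≤ L * r := by
    refine le_of_mul_le_mul_right ?_ hrd
    linarith
  have h3 : |v t r| * (ρ t 0 / 2) ≤ |v t r| * ρ t r := by gcongr
  rw [div_mul_eq_mul_div, le_div_iff₀ hρ]
  linarith

theorem velocity_zero (S : IsRadialSolution (d + 1) lam ρ₀ v₀ ⊤ ρ v Φ) {t : ℝ}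
    (ht : 0 < t) (hρ : 0 < ρ t 0) : v t 0 = 0 := by
  obtain ⟨K, hK⟩ := S.exists_abs_velocity_le ht hρ
  have hv : Tendsto (v t) (𝓝[>] 0) (𝓝 (v t 0)) :=
    ((S.memCD_velocity.continuousOn_space ht.le) 0 self_mem_Ici).mono_left
      (nhdsWithin_mono _ Ioi_subset_Ici_self)
  have h0 : Tendsto (fun r => K * r) (𝓝[>] (0 : ℝ)) (𝓝 0) := by
    have : Continuous fun r : ℝ => K * r := by fun_prop
    simpa using (this.tendsto 0).mono_left nhdsWithin_le_nhds
  exact tendsto_nhds_unique hv (squeeze_zero_norm' hK h0)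

/-- There is no point mass at the centre while the central density is positive. -/
theorem flux_eq_mass (S : IsRadialSolution (d + 1) lam ρ₀ v₀ ⊤ ρ v Φ) (hlam : lam ≠ 0) {t : ℝ}
    (ht : 0 < t) (hρ : 0 < ρ t 0) {r : ℝ} (hr : 0 < r) :
    r ^ d * deriv (Φ t) r = mass (d + 1) ρ t r := by
  obtain ⟨C, hC⟩ := S.exists_flux_eq_mass_add ht.le
  suffices hC0 : C = 0 by rw [hC r hr, hC0, add_zero]
  -- The acceleration vanishes at the centre, since `v(τ, 0) = 0` for `τ` near `t`.
  have hρt : ∀ᶠ τ in 𝓝 t, 0 < ρ τ 0 :=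
    (S.memCD_density.hasDerivAt_time (by norm_num) ht le_rfl).continuousAt.eventually
      (lt_mem_nhds hρ)
  have hvt0 : derivWithin (fun τ => v τ 0) (Ici 0) t = 0 := by
    have h1 : (fun τ => v τ 0) =ᶠ[𝓝 t] fun _ => 0 := by
      filter_upwards [hρt, Ioi_mem_nhds ht] with τ h1 h2 using S.velocity_zero h2 h1
    rw [derivWithin_of_mem_nhds (Ici_mem_nhds ht), h1.deriv_eq, deriv_const]
  have hvt : Tendsto (fun r => derivWithin (fun τ => v τ r) (Ici 0) t) (𝓝[>] 0) (𝓝 0) := by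
    have hD : ContinuousOn (fun s => derivWithin (fun τ => v τ s) (Ici 0) t) (Ici 0) :=
      (S.memCD_velocity.continuousOn_derivWithin_time le_rfl).comp (f := fun s => (t, s))
        (by fun_prop) fun s hs => ⟨ht.le, hs⟩
    have := (hD 0 self_mem_Ici).mono_left (nhdsWithin_mono (0 : ℝ) Ioi_subset_Ici_self)
    simpa only [hvt0] using this
  have hvc := S.memCD_velocity.continuousOn_space ht.le
  have hΦc := S.memCD_potential.continuousOn_space ht.le
  have hΦd : ∀ r, 0 < r → HasDerivAt (Φ t) (deriv (Φ t) r) r := fun r hr =>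
    S.memCD_potential.hasDerivAt_space (by norm_num) ht.le hr
  -- The Bernoulli function `v²/2 + lam Φ` has derivative `-v_t`, hence zero slope at `r = 0`.
  have hψd : ∀ r, 0 < r → HasDerivAt (fun r => v t r ^ 2 / 2 + lam * Φ t r)
      (-derivWithin (fun τ => v τ r) (Ici 0) t) r := by
    intro r hr
    have h1 := ((S.memCD_velocity.hasDerivAt_space le_rfl ht.le hr).pow 2).div_const 2
    convert! h1.add ((hΦd r hr).const_mul lam) using 1
    have := S.momentum ht.le hr
    simp; linarith
  have hψ : HasDerivWithinAt (fun r => v t r ^ 2 / 2 + lam * Φ t r) 0 (Ici 0) 0 := by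
    refine hasDerivWithinAt_Ici_of_tendsto_deriv (s := Ioi 0)
      (fun r hr => (hψd r hr).differentiableAt.differentiableWithinAt)
      ((((hvc.pow 2).div_const 2).add (hΦc.const_mul lam) 0 self_mem_Ici).mono
        Ioi_subset_Ici_self) self_mem_nhdsWithin ?_
    have hneg := hvt.neg
    rw [neg_zero] at hneg
    refine hneg.congr' ?_
    filter_upwards [self_mem_nhdsWithin] with r hr using (hψd r hr).deriv.symm
  have hψs : Tendsto (fun r => r⁻¹ * (v t r ^ 2 / 2 + lam * Φ t r - lam * Φ t 0)) (𝓝[>] 0)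
      (𝓝 0) := by
    have := (hasDerivWithinAt_iff_tendsto_slope' self_notMem_Ioi).1 hψ.Ioi_of_Ici
    simpa [slope_fun_def, S.velocity_zero ht hρ] using this
  obtain ⟨K, hK⟩ := S.exists_abs_velocity_le ht hρ
  have hv2 : Tendsto (fun r => r⁻¹ * (v t r ^ 2 / 2)) (𝓝[>] 0) (𝓝 0) := by
    have h0 : Tendsto (fun r => K ^ 2 / 2 * r) (𝓝[>] (0 : ℝ)) (𝓝 0) := by
      have : Continuous fun r : ℝ => K ^ 2 / 2 * r := by fun_prop
      simpa using (this.tendsto 0).mono_left nhdsWithin_le_nhds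
    refine squeeze_zero_norm' ?_ h0
    filter_upwards [hK, self_mem_nhdsWithin] with r h1 hr
    have hr : 0 < r := hr
    rw [Real.norm_of_nonneg (by positivity), inv_mul_le_iff₀ hr]
    have : v t r ^ 2 ≤ (K * r) ^ 2 := by
      rw [← sq_abs]; exact pow_le_pow_left₀ (abs_nonneg _) h1 2
    linarith
  -- As `v² = O(r²)`, the potential has zero slope at `r = 0`; the factor `C` fixes the sign below.
  have hΦs : Tendsto (fun r => C * ((Φ t r - Φ t 0) / r)) (𝓝[>] 0) (𝓝 0) := by
    have := (hψs.sub hv2).const_mul (C / lam)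
    rw [sub_zero, mul_zero] at this
    refine this.congr' ?_
    filter_upwards [self_mem_nhdsWithin] with r hr
    have hr : r ≠ 0 := (show 0 < r from hr).ne'
    field_simp; ring
  by_contra hC0
  have hC2 : 0 < C ^ 2 / 2 := by positivity
  -- If `C ≠ 0`, then `C * Φ_r ≥ C² / 2` near the centre, because `r ^ d ≤ 1` and `m → 0`.
  have hm0 : Tendsto (fun r => mass (d + 1) ρ t r) (𝓝[>] 0) (𝓝 0) := by
    have hc : ContinuousOn (fun r => mass (d + 1) ρ t r) (Ici 0) :=
      (continuousOn_mass S.memCD_density.continuousOn_zero).comp (f := fun r => (t, r))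
        (by fun_prop) fun s hs => ⟨ht.le, hs⟩
    have := (hc 0 self_mem_Ici).mono_left (nhdsWithin_mono (0 : ℝ) Ioi_subset_Ici_self)
    simpa [mass] using this
  have hflux : ∀ᶠ r in 𝓝[>] (0 : ℝ), C ^ 2 / 2 ≤ C * deriv (Φ t) r := by
    have h1 : Tendsto (fun r => C * (mass (d + 1) ρ t r + C)) (𝓝[>] 0) (𝓝 (C ^ 2)) := by
      have := (hm0.add_const C).const_mul C
      rwa [zero_add, ← sq] at this
    filter_upwards [h1.eventually (lt_mem_nhds (half_lt_self (by positivity : 0 < C ^ 2))),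
      Ioo_mem_nhdsGT one_pos] with r h2 hr
    rw [← hC r hr.1] at h2
    have h3 : r ^ d ≤ 1 := pow_le_one₀ hr.1.le hr.2.le
    have h4 : 0 < r ^ d := pow_pos hr.1 d
    have h5 : 0 < r ^ d * (C * deriv (Φ t) r) := by linarith
    have h6 : 0 < C * deriv (Φ t) r := pos_of_mul_pos_right h5 h4.le
    nlinarith
  obtain ⟨δ, hδ, hδf⟩ := (mem_nhdsGT_iff_exists_Ioo_subset).1 hflux
  have hsmall := hΦs.eventually (gt_mem_nhds hC2)
  obtain ⟨r, hr1, hr2⟩ := (hsmall.and (Ioo_mem_nhdsGT hδ)).exists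
  obtain ⟨c, hc, hce⟩ := exists_hasDerivAt_eq_slope (fun r => C * Φ t r)
    (fun r => C * deriv (Φ t) r) hr2.1
    ((hΦc.const_mul C).mono Icc_subset_Ici_self) fun x hx => (hΦd x hx.1).const_mul C
  have := hδf ⟨hc.1, hc.2.trans hr2.2⟩
  simp only [mem_ofPred_eq] at this
  rw [hce, sub_zero, ← mul_sub, mul_div_assoc] at this
  linarith

/-- Along the curves `r = R a(t)` of the homogeneous flow, the velocity and the mass of any solution
are those of the homogeneous solution. -/
theorem along_homogeneous_flow {ρc : ℝ}
    (S : IsRadialSolution (d + 1) lam (fun _ => ρc) (fun _ => 0) ⊤ ρ v Φ) {t₁ : ℝ} (ht₁ : 0 ≤ t₁)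
    {a b : ℝ → ℝ} (ha0 : a 0 = 1) (hb0 : b 0 = 0) (hpos : ∀ t ∈ Icc 0 t₁, 0 < a t)
    (ha : ∀ t ∈ Icc 0 t₁, HasDerivAt a (b t) t)
    (hb : ∀ t ∈ Icc 0 t₁, HasDerivAt b (-(lam * ρc / (d + 1 : ℕ)) / a t ^ d) t)
    (hflux : ∀ t ∈ Ioo 0 t₁, ∀ r, 0 < r → r ^ d * deriv (Φ t) r = mass (d + 1) ρ t r)
    {R : ℝ} (hR : 0 < R) {t : ℝ} (ht : t ∈ Icc 0 t₁) :
    v t (R * a t) = R * b t ∧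
      mass (d + 1) ρ t (R * a t) = ρc * R ^ (d + 1) / (d + 1 : ℕ) := by
  have hac : ContinuousOn a (Icc 0 t₁) := fun t ht => (ha t ht).continuousAt.continuousWithinAt
  have hbc : ContinuousOn b (Icc 0 t₁) := fun t ht => (hb t ht).continuousAt.continuousWithinAt
  have hcurve : ContinuousOn (fun t => (t, R * a t)) (Icc 0 t₁) :=
    continuousOn_id.prodMk (hac.const_mul R)
  have hRa : ∀ t ∈ Icc 0 t₁, 0 < R * a t := fun t ht => mul_pos hR (hpos t ht)
  have maps : MapsTo (fun t => (t, R * a t)) (Icc 0 t₁) (Ici 0 ×ˢ Ici 0) := fun t ht =>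
    ⟨ht.1, (hRa t ht).le⟩
  have maps' : MapsTo (fun t => (t, R * a t)) (Icc 0 t₁) (Ici 0 ×ˢ Ioi 0) := fun t ht =>
    ⟨ht.1, hRa t ht⟩
  have hρc := S.memCD_density.continuousOn_zero.comp hcurve maps
  have hopen : IsOpen (Ioi (0 : ℝ) ×ˢ Ioi (0 : ℝ)) := isOpen_Ioi.prod isOpen_Ioi
  have hsub : Ioi (0 : ℝ) ×ˢ Ioi (0 : ℝ) ⊆ Ici 0 ×ˢ Ici 0 :=
    prod_mono Ioi_subset_Ici_self Ioi_subset_Ici_self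
  have hsub' : Ioi (0 : ℝ) ×ˢ Ioi (0 : ℝ) ⊆ Ici 0 ×ˢ Ioi 0 :=
    prod_mono Ioi_subset_Ici_self subset_rfl
  have hlin := eq_zero_of_linear_system (w := fun t => v t (R * a t) - R * b t)
    (m := fun t => mass (d + 1) ρ t (R * a t) - ρc * R ^ (d + 1) / (d + 1 : ℕ))
    (α := fun t => -deriv (v t) (R * a t)) (β := fun t => -lam / (R * a t) ^ d)
    (γ := fun t => -(ρ t (R * a t) * (R * a t) ^ d)) ht₁
    ((S.memCD_velocity.continuousOn_zero.comp hcurve maps).sub (hbc.const_mul R))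
    (((continuousOn_mass S.memCD_density.continuousOn_zero).comp hcurve maps).sub
      continuousOn_const)
    ((S.memCD_velocity.continuousOn_deriv_space le_rfl).comp hcurve maps').neg
    (continuousOn_const.div ((hac.const_mul R).pow d) fun t ht => (pow_pos (hRa t ht) d).ne')
    (hρc.mul ((hac.const_mul R).pow d)).neg
    (fun t ht => ?_) (fun t ht => ?_) ?_ ?_ t ht
  · exact ⟨sub_eq_zero.1 hlin.1, sub_eq_zero.1 hlin.2⟩
  · have ht' := Ioo_subset_Icc_self ht
    have hv := hasDerivAt_along_curve (f := v)
      (f₁ := fun t r => derivWithin (fun τ => v τ r) (Ici 0) t) (f₂ := fun t r => deriv (v t) r)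
      hopen
      (fun p hp => S.memCD_velocity.hasDerivAt_time le_rfl hp.1 (le_of_lt hp.2))
      (fun p hp => S.memCD_velocity.hasDerivAt_space le_rfl (mem_Ici.2 (le_of_lt hp.1)) hp.2)
      ((S.memCD_velocity.continuousOn_derivWithin_time le_rfl).mono hsub)
      ((S.memCD_velocity.continuousOn_deriv_space le_rfl).mono hsub')
      ((ha t ht').const_mul R) (show (t, R * a t) ∈ _ from ⟨ht.1, hRa t ht'⟩)
    convert! hv.sub ((hb t ht').const_mul R) using 1
    have hm := S.momentum ht.1.le (hRa t ht')
    have hf := hflux t ht _ (hRa t ht')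
    have hp := hpos t ht'
    have hD : deriv (Φ t) (R * a t) = mass (d + 1) ρ t (R * a t) / (R * a t) ^ d := by
      rw [← hf, mul_div_cancel_left₀ _ (pow_pos (hRa t ht') d).ne']
    rw [hD] at hm
    have e : R * (-(lam * ρc / (d + 1 : ℕ)) / a t ^ d) =
        -lam / (R * a t) ^ d * (ρc * R ^ (d + 1) / (d + 1 : ℕ)) := by
      rw [mul_pow, pow_succ]; field_simp
    rw [e]
    linear_combination -hm
  · have ht' := Ioo_subset_Icc_self ht
    have hmd := hasDerivAt_along_curve (f := mass (d + 1) ρ)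
      (f₁ := mass (d + 1) (fun τ s => derivWithin (fun τ => ρ τ s) (Ici 0) τ))
      (f₂ := fun t r => ρ t r * r ^ d) hopen
      (fun p hp => hasDerivAt_mass_time S.memCD_density hp.1 (le_of_lt hp.2))
      (fun p hp => hasDerivAt_mass_space
        (S.memCD_density.continuousOn_space (mem_Ici.2 (le_of_lt hp.1))) hp.2)
      ((continuousOn_mass (S.memCD_density.continuousOn_derivWithin_time (by norm_num))).mono hsub)
      ((S.memCD_density.continuousOn_zero.mono hsub).mul (by fun_prop))
      ((ha t ht').const_mul R) (show (t, R * a t) ∈ _ from ⟨ht.1, hRa t ht'⟩)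
    convert! hmd.sub_const (ρc * R ^ (d + 1) / (d + 1 : ℕ)) using 1
    rw [S.mass_time ht.1 (hRa t ht')]
    ring
  · rw [ha0, hb0, mul_one, S.velocity_init R hR.le]; simp
  · rw [ha0, mul_one, mass_congr (h := fun _ _ => ρc) hR.le fun s hs => S.density_init s hs,
      mass_const d (fun _ => ρc)]
    ring

/-- The mass along the homogeneous flow determines the density, by differentiation in `r`, and by
continuity at the centre. -/
theorem density_eq_of_along_flow {ρc : ℝ} (S : IsRadialSolution (d + 1) lam ρ₀ v₀ ⊤ ρ v Φ) {t : ℝ}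
    (ht : 0 ≤ t) {a : ℝ} (ha : 0 < a)
    (hm : ∀ R, 0 < R → mass (d + 1) ρ t (R * a) = ρc * R ^ (d + 1) / (d + 1 : ℕ)) {r : ℝ}
    (hr : 0 ≤ r) : ρ t r = ρc / a ^ (d + 1) := by
  have hρ := S.memCD_density.continuousOn_space ht
  have hpos : ∀ r, 0 < r → ρ t r = ρc / a ^ (d + 1) := by
    intro r hr
    have h1 := hasDerivAt_mass_space (d := d) hρ hr
    have h2 : HasDerivAt (fun x => mass (d + 1) ρ t x) (ρc / a ^ (d + 1) * r ^ d) r := by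
      have h3 := ((hasDerivAt_pow (d + 1) r).div_const ((d + 1 : ℕ) : ℝ)).const_mul
        (ρc / a ^ (d + 1))
      rw [add_tsub_cancel_right, mul_div_cancel_left₀ _ (by positivity)] at h3
      refine h3.congr_of_eventuallyEq ?_
      filter_upwards [Ioi_mem_nhds hr] with x hx
      have := hm (x / a) (div_pos hx ha)
      rw [div_mul_cancel₀ _ ha.ne'] at this
      rw [this, div_pow]; ring
    exact mul_right_cancel₀ (pow_pos hr d).ne' (h1.unique h2)
  rcases hr.eq_or_lt with rfl | hr
  · have h1 : Tendsto (ρ t) (𝓝[>] 0) (𝓝 (ρ t 0)) :=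
      (hρ 0 self_mem_Ici).mono_left (nhdsWithin_mono _ Ioi_subset_Ici_self)
    refine tendsto_nhds_unique (h1.congr' ?_) tendsto_const_nhds
    filter_upwards [self_mem_nhdsWithin] with r hr using hpos r hr
  · exact hpos r hr

theorem density_center_pos {ρc : ℝ} (hρc : 0 < ρc) (hlam : lam ≠ 0)
    (S : IsRadialSolution (d + 1) lam (fun _ => ρc) (fun _ => 0) ⊤ ρ v Φ) {t₁ : ℝ}
    {a b : ℝ → ℝ} (ha0 : a 0 = 1) (hb0 : b 0 = 0) (hpos : ∀ t ∈ Icc 0 t₁, 0 < a t)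
    (ha : ∀ t ∈ Icc 0 t₁, HasDerivAt a (b t) t)
    (hb : ∀ t ∈ Icc 0 t₁, HasDerivAt b (-(lam * ρc / (d + 1 : ℕ)) / a t ^ d) t)
    {t : ℝ} (ht : t ∈ Icc 0 t₁) : 0 < ρ t 0 := by
  by_contra hcon
  push Not at hcon
  have hc : ContinuousOn (fun t => ρ t 0) (Icc 0 t₁) :=
    S.memCD_density.continuousOn_zero.comp (f := fun t => (t, (0 : ℝ))) (by fun_prop)
      fun s hs => ⟨hs.1, self_mem_Ici⟩
  have hcomp : IsCompact (Icc 0 t₁ ∩ (fun t => ρ t 0) ⁻¹' Iic 0) :=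
    isCompact_Icc.of_isClosed_subset (hc.preimage_isClosed_of_isClosed isClosed_Icc isClosed_Iic)
      inter_subset_left
  -- The first time `t₀` at which the central density fails to be positive.
  obtain ⟨t₀, ⟨ht₀, hle⟩, hmin⟩ := hcomp.exists_isLeast ⟨t, ht, hcon⟩
  have hsub : Icc 0 t₀ ⊆ Icc 0 t₁ := Icc_subset_Icc_right ht₀.2
  have hflow := fun R hR => (S.along_homogeneous_flow ht₀.1 ha0 hb0 (fun t ht => hpos t (hsub ht))
    (fun t ht => ha t (hsub ht)) (fun t ht => hb t (hsub ht))
    (fun τ hτ r hr => S.flux_eq_mass hlam hτ.1 (by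
      by_contra hneg
      exact (hmin ⟨hsub (Ioo_subset_Icc_self hτ), not_lt.1 hneg⟩).not_gt hτ.2) hr)
    (R := R) hR (right_mem_Icc.2 ht₀.1)).2
  have := S.density_eq_of_along_flow ht₀.1 (hpos t₀ ht₀) hflow le_rfl
  have h2 : 0 < ρ t₀ 0 := by
    rw [this]; exact div_pos hρc (pow_pos (hpos t₀ ht₀) _)
  exact h2.not_ge hle

/-- A global solution agrees with the homogeneous one on every time interval on which the scale
factor stays positive. -/
theorem eq_homogeneous {ρc : ℝ} (hρc : 0 < ρc) (hlam : lam ≠ 0)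
    (S : IsRadialSolution (d + 1) lam (fun _ => ρc) (fun _ => 0) ⊤ ρ v Φ) {t₁ : ℝ} (ht₁ : 0 < t₁)
    {a b : ℝ → ℝ} (ha0 : a 0 = 1) (hb0 : b 0 = 0) (hpos : ∀ t ∈ Icc 0 t₁, 0 < a t)
    (ha : ∀ t ∈ Icc 0 t₁, HasDerivAt a (b t) t)
    (hb : ∀ t ∈ Icc 0 t₁, HasDerivAt b (-(lam * ρc / (d + 1 : ℕ)) / a t ^ d) t)
    {t : ℝ} (ht : t ∈ Icc 0 t₁) {r : ℝ} (hr : 0 ≤ r) :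
    ρ t r = homogeneousDensity (d + 1) ρc a t r ∧ v t r = hubbleVelocity a b t r ∧
      Φ t r - Φ t 0 = homogeneousPotential (d + 1) ρc a t r := by
  have hflux : ∀ τ ∈ Ioo 0 t₁, ∀ r, 0 < r → r ^ d * deriv (Φ τ) r = mass (d + 1) ρ τ r :=
    fun τ hτ r hr => S.flux_eq_mass hlam hτ.1
      (S.density_center_pos hρc hlam ha0 hb0 hpos ha hb (Ioo_subset_Icc_self hτ)) hr
  have hflow : ∀ τ ∈ Icc 0 t₁, ∀ R, 0 < R → v τ (R * a τ) = R * b τ ∧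
      mass (d + 1) ρ τ (R * a τ) = ρc * R ^ (d + 1) / (d + 1 : ℕ) := fun τ hτ R hR =>
    S.along_homogeneous_flow (hτ.1.trans hτ.2) ha0 hb0 hpos ha hb hflux hR hτ
  refine ⟨S.density_eq_of_along_flow ht.1 (hpos t ht) (fun R hR => (hflow t ht R hR).2) hr,
    ?_, ?_⟩
  · have hv : ∀ r, 0 < r → v t r = hubbleVelocity a b t r := fun r hr => by
      have := (hflow t ht (r / a t) (div_pos hr (hpos t ht))).1
      rw [div_mul_cancel₀ _ (hpos t ht).ne'] at this
      rw [this, hubbleVelocity]; ring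
    rcases hr.eq_or_lt with rfl | hr
    · have h1 : Tendsto (v t) (𝓝[>] 0) (𝓝 (v t 0)) :=
        (S.memCD_velocity.continuousOn_space ht.1 0 self_mem_Ici).mono_left
          (nhdsWithin_mono _ Ioi_subset_Ici_self)
      have h2 : Tendsto (hubbleVelocity a b t) (𝓝[>] 0) (𝓝 (hubbleVelocity a b t 0)) :=
        ((continuous_const.mul continuous_id).tendsto 0).mono_left nhdsWithin_le_nhds
      refine tendsto_nhds_unique (h1.congr' ?_) h2
      filter_upwards [self_mem_nhdsWithin] with r hr using hv r hr
    · exact hv r hr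
  -- The potential is found by integrating its gradient for `0 < t < t₁`; the end points follow by
  -- continuity in time.
  · have hgrad : ∀ τ ∈ Ioo 0 t₁, Φ τ r - Φ τ 0 = homogeneousPotential (d + 1) ρc a τ r := by
      intro τ hτ
      have hτ' := Ioo_subset_Icc_self hτ
      have hder : ∀ x ∈ Ioo 0 r, HasDerivAt
          (fun x => Φ τ x - homogeneousPotential (d + 1) ρc a τ x) 0 x := by
        intro x hx
        have h1 := S.memCD_potential.hasDerivAt_space (by norm_num) hτ'.1 hx.1
        convert! h1.sub (hasDerivAt_homogeneousPotential (d + 1) ρc a τ x) using 1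
        have h2 := hflux τ hτ x hx.1
        have h3 := (hflow τ hτ' (x / a τ) (div_pos hx.1 (hpos τ hτ'))).2
        rw [div_mul_cancel₀ _ (hpos τ hτ').ne'] at h3
        rw [h3] at h2
        rw [eq_comm, sub_eq_zero]
        refine mul_left_cancel₀ (pow_pos hx.1 d).ne' (h2.trans ?_)
        rw [div_pow, pow_succ x d]
        ring
      have hcont : ContinuousOn (fun x => Φ τ x - homogeneousPotential (d + 1) ρc a τ x)
          (Icc 0 r) :=
        ((S.memCD_potential.continuousOn_space hτ'.1).mono Icc_subset_Ici_self).sub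
          (fun x _ => (hasDerivAt_homogeneousPotential (d + 1) ρc a τ x
            ).continuousAt.continuousWithinAt)
      rcases hr.eq_or_lt with rfl | hr
      · simp [homogeneousPotential]
      obtain ⟨c, -, hc⟩ := exists_hasDerivAt_eq_slope _ _ hr hcont hder
      rw [eq_comm, div_eq_zero_iff, or_iff_left (sub_pos.2 hr).ne'] at hc
      simp only [homogeneousPotential, zero_pow two_ne_zero, mul_zero, sub_zero] at hc ⊢
      linarith
    have hΦc : ∀ x, 0 ≤ x → ContinuousOn (fun τ => Φ τ x) (Icc 0 t₁) := fun x hx =>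
      S.memCD_potential.continuousOn_zero.comp (f := fun τ => (τ, x)) (by fun_prop)
        fun τ hτ => ⟨hτ.1, hx⟩
    have hac : ContinuousOn a (Icc 0 t₁) := fun t ht => (ha t ht).continuousAt.continuousWithinAt
    refine EqOn.of_subset_closure (f := fun τ => Φ τ r - Φ τ 0)
      (g := fun τ => homogeneousPotential (d + 1) ρc a τ r) hgrad ((hΦc r hr).sub (hΦc 0 le_rfl))
      (((continuousOn_const.div (hac.pow _) fun τ hτ => (pow_pos (hpos τ hτ) _).ne').div_const
        _).mul_const _) Ioo_subset_Icc_self (closure_Ioo ht₁.ne).ge ht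

end IsRadialSolution

/-! ### Local existence, breakdown and global existence -/

theorem exists_local_solution (d : ℕ) (lam ρc : ℝ) :
    ∃ T : EReal, 0 < T ∧ ∃ ρ v Φ : ℝ → ℝ → ℝ,
      IsRadialSolution (d + 1) lam (fun _ => ρc) (fun _ => 0) T ρ v Φ := by
  obtain ⟨a, b, ha0, hb0, ha, hb⟩ :=
    exists_truncated_scaleFactor d (lam * ρc / (d + 1 : ℕ)) (half_pos (zero_lt_one' ℝ))
  have hac : Continuous a := continuous_iff_continuousAt.2 fun t => (ha t).continuousAt
  obtain ⟨ha2, hb1⟩ := contDiff_two_of_hasDerivAt ha hb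
    (continuous_const.div ((hac.max continuous_const).pow d)
      fun t => (pow_pos (lt_max_of_lt_right one_half_pos) d).ne')
  have hnear : ∀ᶠ t in 𝓝 (0 : ℝ), 1 / 2 < a t :=
    (hac.tendsto 0).eventually (lt_mem_nhds (by rw [ha0]; norm_num))
  obtain ⟨T, hT, hball⟩ := Metric.eventually_nhds_iff.1 hnear
  have hI : timeInterval (T : EReal) = Ico 0 T := timeInterval_coe T
  have hlow : ∀ t ∈ timeInterval (T : EReal), 1 / 2 < a t := fun t ht => by
    rw [hI] at ht
    exact hball (by rw [Real.dist_eq, sub_zero, abs_of_nonneg ht.1]; exact ht.2)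
  refine ⟨T, by exact_mod_cast hT, _, _, _, isRadialSolution_homogeneous d lam ρc (a := a) (b := b)
    (by rw [hI]; exact uniqueDiffOn_Ico 0 T) (fun t ht => one_half_pos.trans (hlow t ht))
    ha0 hb0 (fun t _ => ha t) (fun t ht => ?_) ha2 hb1⟩
  have := hb t
  rwa [max_eq_left (hlow t ht).le] at this

/-- For an attractive force the density would be unbounded on `[0, √(2/k)]` at `r = 1`. -/
theorem not_global_of_pos (d : ℕ) {lam ρc : ℝ} (hlam : 0 < lam) (hρc : 0 < ρc)
    {ρ v Φ : ℝ → ℝ → ℝ} :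
    ¬ IsRadialSolution (d + 1) lam (fun _ => ρc) (fun _ => 0) ⊤ ρ v Φ := by
  intro S
  have hk : 0 < lam * ρc / (d + 1 : ℕ) := by positivity
  have hc : ContinuousOn (fun t => ρ t 1) (Icc 0 √(2 / (lam * ρc / (d + 1 : ℕ)))) :=
    S.memCD_density.continuousOn_zero.comp (f := fun t => (t, (1 : ℝ))) (by fun_prop)
      fun t ht => ⟨ht.1, mem_Ici.2 zero_le_one⟩
  obtain ⟨B, hB⟩ := isCompact_Icc.exists_bound_of_continuousOn hc
  have hB0 : 0 ≤ B := (norm_nonneg _).trans (hB 0 ⟨le_rfl, Real.sqrt_nonneg _⟩)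
  -- With this choice `ρc / ε ^ (d + 1) ≥ ρc / ε ≥ B + 1`.
  set ε := min (1 / 2) (ρc / (B + 1)) with hε
  have hε0 : 0 < ε := lt_min one_half_pos (by positivity)
  have hε1 : ε < 1 := (min_le_left _ _).trans_lt one_half_lt_one
  obtain ⟨a, b, t₁, ht₁, htle, ha0, hb0, hat, hge, ha, hb⟩ :=
    exists_scaleFactor_hitting_of_pos d hk hε0 hε1
  have h := (S.eq_homogeneous hρc hlam.ne' ht₁ ha0 hb0 (fun t ht => hε0.trans_le (hge t ht))
    (fun t _ => ha t) hb (right_mem_Icc.2 ht₁.le) zero_le_one).1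
  have h1 := (le_abs_self _).trans (hB t₁ ⟨ht₁.le, htle⟩)
  rw [h, homogeneousDensity, hat, div_le_iff₀ (pow_pos hε0 _)] at h1
  have h2 : ε ^ (d + 1) ≤ ε := by
    simpa using pow_le_pow_of_le_one hε0.le hε1.le (Nat.le_add_left 1 d)
  have h3 : ε * (B + 1) ≤ ρc := (le_div_iff₀ (by positivity)).1 (min_le_right _ _)
  nlinarith

theorem exists_global_solution (d : ℕ) {lam ρc : ℝ} (hlam : lam < 0) (hρc : 0 < ρc) :
    ∃ ρ v Φ : ℝ → ℝ → ℝ,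
      IsRadialSolution (d + 1) lam (fun _ => ρc) (fun _ => 0) ⊤ ρ v Φ ∧
      ContinuityEquation (d + 1) ⊤ ρ v ∧
      (∀ t : ℝ, 0 ≤ t → v t 0 = 0 ∧ Φ t 0 = 0) ∧
      (MemCD 2 ⊤ (Set.Ici 0) ρ ∧ MemCD ⊤ ⊤ (Set.Ioi 0) ρ) ∧
      (MemCD 1 ⊤ (Set.Ici 0) v ∧ MemCD ⊤ ⊤ (Set.Ioi 0) v) ∧
      (MemCD 2 ⊤ (Set.Ici 0) Φ ∧ MemCD ⊤ ⊤ (Set.Ioi 0) Φ) ∧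
      (∀ ρ' v' Φ' : ℝ → ℝ → ℝ,
        IsRadialSolution (d + 1) lam (fun _ => ρc) (fun _ => 0) ⊤ ρ' v' Φ' →
        ∀ t : ℝ, 0 ≤ t → ∀ r : ℝ, 0 ≤ r →
          ρ' t r = ρ t r ∧ v' t r = v t r ∧ Φ' t r - Φ' t 0 = Φ t r) ∧
      IsDistributionalSolution lam (radialScalar (d + 1) ρ) (radialVector (d + 1) v)
        (radialScalar (d + 1) Φ) := by
  have hk : lam * ρc / (d + 1 : ℕ) < 0 :=
    div_neg_of_neg_of_pos (mul_neg_of_neg_of_pos hlam hρc) (by positivity)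
  obtain ⟨a, b, ha0, hb0, ha1, ha, hb⟩ := exists_scaleFactor_of_neg d hk
  have hpos : ∀ t, 0 < a t := fun t => one_pos.trans_le (ha1 t)
  obtain ⟨has, hbs⟩ := contDiff_infty_scaleFactor hpos ha hb
  have hI : UniqueDiffOn ℝ (timeInterval ⊤) := by
    rw [timeInterval_top]; exact uniqueDiffOn_Ici 0
  have ak : ∀ {k : ℕ∞} {I : Set ℝ}, ContDiffOn ℝ k a I := fun {k I} =>
    (has.of_le (by exact_mod_cast le_top)).contDiffOn
  have bk : ∀ {k : ℕ∞} {I : Set ℝ}, ContDiffOn ℝ k b I := fun {k I} =>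
    (hbs.of_le (by exact_mod_cast le_top)).contDiffOn
  have a1 : ContDiff ℝ 1 a := has.of_le (by norm_cast)
  have b1 : ContDiff ℝ 1 b := hbs.of_le (by norm_cast)
  have g1 : ContDiff ℝ 1 (fun t => ρc / a t ^ (d + 1)) :=
    contDiff_const.div (a1.pow _) fun t => (pow_pos (hpos t) _).ne'
  refine ⟨homogeneousDensity (d + 1) ρc a, hubbleVelocity a b, homogeneousPotential (d + 1) ρc a,
    isRadialSolution_homogeneous d lam ρc hI (fun t _ => hpos t) ha0 hb0 (fun t _ => ha t)
      (fun t _ => hb t) (has.of_le (by norm_cast)) b1,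
    continuityEquation_homogeneous d ρc hI (fun t _ => hpos t) fun t _ => ha t,
    fun t _ => by simp [hubbleVelocity, homogeneousPotential],
    ⟨memCD_homogeneousDensity (uniqueDiffOn_Ici 0) _ _ ak fun t _ => hpos t,
      memCD_homogeneousDensity (uniqueDiffOn_Ioi 0) _ _ ak fun t _ => hpos t⟩,
    ⟨memCD_hubbleVelocity (uniqueDiffOn_Ici 0) ak bk fun t _ => hpos t,
      memCD_hubbleVelocity (uniqueDiffOn_Ioi 0) ak bk fun t _ => hpos t⟩,
    ⟨memCD_homogeneousPotential (uniqueDiffOn_Ici 0) _ _ ak fun t _ => hpos t,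
      memCD_homogeneousPotential (uniqueDiffOn_Ioi 0) _ _ ak fun t _ => hpos t⟩,
    fun ρ' v' Φ' S t ht r hr => S.eq_homogeneous hρc hlam.ne (t₁ := t + 1) (by linarith) ha0 hb0
      (fun t _ => hpos t) (fun t _ => ha t) (fun t _ => hb t) ⟨ht, by linarith⟩ hr, ?_⟩
  have hvec : radialVector (d + 1) (hubbleVelocity a b) =
      fun p : SpaceTime (d + 1) => (b p.1 / a p.1) • p.2 := by
    ext1 p
    rw [radialVector, hubbleVelocity]
    rcases eq_or_ne p.2 0 with h | h
    · simp [h]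
    · rw [mul_div_cancel_right₀ _ (norm_ne_zero_iff.2 h)]
  rw [hvec]
  refine isDistributionalSolution_homogeneous (g := fun t => ρc / a t ^ (d + 1))
    (q := fun t => ρc / a t ^ (d + 1) / (2 * (d + 1 : ℕ))) (h := fun t => b t / a t) g1
    (b1.div a1 fun t => (hpos t).ne') (g1.div_const _)
    (fun t => hasDerivAt_homogeneousDensity d ρc (hpos t) (ha t))
    (fun t => hasDerivAt_hubbleRate (hpos t) (ha t) (hb t)) (fun t => by ring) (fun t => ?_)
    (fun t => by field_simp) (by simp [hb0])
  field_simp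
  ring

end EulerPoisson

open EulerPoisson in
theorem corollary1p18 (n : ℕ) (hn : 1 ≤ n) (lam : ℝ) (hlam : lam ≠ 0)
    (ρc : ℝ) (hρc : 0 < ρc) :
    (∃ T : EReal, 0 < T ∧ ∃ ρ v Φ : ℝ → ℝ → ℝ,
      IsRadialSolution n lam (fun _ => ρc) (fun _ => 0) T ρ v Φ) ∧
    ((∃ ρ v Φ : ℝ → ℝ → ℝ,
      IsRadialSolution n lam (fun _ => ρc) (fun _ => 0) ⊤ ρ v Φ) ↔ lam < 0) ∧
    (lam < 0 → ∃ ρ v Φ : ℝ → ℝ → ℝ,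
      IsRadialSolution n lam (fun _ => ρc) (fun _ => 0) ⊤ ρ v Φ ∧
      ContinuityEquation n ⊤ ρ v ∧
      (∀ t : ℝ, 0 ≤ t → v t 0 = 0 ∧ Φ t 0 = 0) ∧
      (MemCD 2 ⊤ (Set.Ici 0) ρ ∧ MemCD ⊤ ⊤ (Set.Ioi 0) ρ) ∧
      (MemCD 1 ⊤ (Set.Ici 0) v ∧ MemCD ⊤ ⊤ (Set.Ioi 0) v) ∧
      (MemCD 2 ⊤ (Set.Ici 0) Φ ∧ MemCD ⊤ ⊤ (Set.Ioi 0) Φ) ∧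
      (∀ ρ' v' Φ' : ℝ → ℝ → ℝ,
        IsRadialSolution n lam (fun _ => ρc) (fun _ => 0) ⊤ ρ' v' Φ' →
        ∀ t : ℝ, 0 ≤ t → ∀ r : ℝ, 0 ≤ r →
          ρ' t r = ρ t r ∧ v' t r = v t r ∧ Φ' t r - Φ' t 0 = Φ t r) ∧
      IsDistributionalSolution lam (radialScalar n ρ) (radialVector n v) (radialScalar n Φ)) := by
  obtain ⟨d, rfl⟩ := Nat.exists_eq_add_of_le' hn
  refine ⟨exists_local_solution d lam ρc, ⟨?_, fun h => ?_⟩,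
    fun h => exists_global_solution d h hρc⟩
  · rintro ⟨ρ, v, Φ, S⟩
    exact hlam.lt_or_gt.resolve_right fun h => not_global_of_pos d h hρc S
  · obtain ⟨ρ, v, Φ, S, -⟩ := exists_global_solution d h hρc
    exact ⟨ρ, v, Φ, S⟩
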